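/- Conventions. Lie groups are real, smooth and finite-dimensional; $L(G)=T_\varepsilon G$ is the Lie algebra of $G$, with the bracket of left invariant vector fields. The exterior derivative is normalized by $d\alpha(X,Y)=X\alpha(Y)-Y\alpha(X)-\alpha([X,Y])$. A *contact Lie group* is a pair $(G,\alpha^+)$ where $G$ is a Lie group of dimension $2p+1$ (for some $p\ge 0$) and $\alpha^+$ is a left invariant differential $1$-form on $G$ with $\alpha^+\wedge(d\alpha^+)^p$ nowhere zero (such an $\alpha^+$ is called a left invariant contact form). A *symplectic Lie group* is a pair $(K,\Omega^+)$ where $\Omega^+$ is a left invariant symplectic form (closed, nondegenerate $2$-form) on the Lie group $K$. (a) Let $(G,\alpha^+)$ be a contact Lie group whose center $Z(G)$ is not discrete. Then the quotient group $G/Z(G)$, with the quotient topology, is a Lie group for a smooth structure making the canonical projection $\pi:G\to G/Z(G)$ a smooth submersion, and it carries a left invariant symplectic form $\Omega^+$ such that $\pi^*\Omega^+=-d\alpha^+$. (b) Conversely, let $(K,\Omega^+)$ be a symplectic Lie group and $\omega:=\Omega^+_\varepsilon$. Let $G$ be any Lie group whose Lie algebra is identified, by a Lie algebra isomorphism, with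 the central extension $\mathbb{R}\times_\omega L(K)$, i.e. the vector space $\mathbb{R}\times L(K)$ with bracket $[(s,a),(t,b)]=(\omega(a,b),[a,b])$, and let $\pi:L(G)\to L(K)$ be the resulting projection. Then $G$ carries a left invariant contact form $\alpha^+$ such that, with $\alpha:=\alpha^+_\varepsilon$, $\pi^*\omega=-d\alpha$ on $L(G)$, i.e. $\omega(\pi u,\pi v)=-(d\alpha^+)_\varepsilon(u,v)$ for all $u,v\in L(G)$; moreover $\Pi^*\Omega^+=-d\alpha^+$ for every smooth homomorphism $\Pi:G\to K$ whose differential at the identity is $\pi$. -/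

import Mathlib

open scoped Manifold ContDiff

noncomputable section

namespace ContactLie

section Wedge

variable {V : Type*} [AddCommGroup V] [Module ℝ V]

/-- The exterior product of real-valued alternating forms (sum over shuffles):
Mathlib's exterior product `AlternatingMap.domCoprod`, followed by multiplication
`ℝ ⊗ ℝ → ℝ`, with the index set `Fin k ⊕ Fin l` identified with `Fin (k + l)`. -/
def wedge {k l : ℕ} (a : V [⋀^Fin k]→ₗ[ℝ] ℝ) (b : V [⋀^Fin l]→ₗ[ℝ] ℝ) :
    V [⋀^Fin (k + l)]→ₗ[ℝ] ℝ :=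
  ((LinearMap.mul' ℝ ℝ).compAlternatingMap (a.domCoprod b)).domDomCongr finSumFinEquiv

/-- The `p`-fold exterior power `b ∧ ⋯ ∧ b` of a `2`-form, with `b ^ 0 = 1`. -/
def wedgePow (b : V [⋀^Fin 2]→ₗ[ℝ] ℝ) : (p : ℕ) → V [⋀^Fin (2 * p)]→ₗ[ℝ] ℝ
  | 0 => haveI : IsEmpty (Fin (2 * 0)) := inferInstanceAs (IsEmpty (Fin 0))
      AlternatingMap.constOfIsEmpty ℝ V (Fin (2 * 0)) 1
  | p + 1 => wedge (wedgePow b p) b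

end Wedge

section Forms

variable {E : Type*} [NormedAddCommGroup E] [NormedSpace ℝ E]
  {M : Type*} [TopologicalSpace M] [ChartedSpace E M]
  {F : Type*} [NormedAddCommGroup F] [NormedSpace ℝ F]
  {N : Type*} [TopologicalSpace N] [ChartedSpace F N]

variable (E M) in
/-- (Not necessarily smooth) differential `k`-forms on a manifold `M` modelled on `E`. -/
abbrev Form (k : ℕ) : Type _ :=
  ∀ x : M, TangentSpace 𝓘(ℝ, E) x [⋀^Fin k]→L[ℝ] ℝ

/-- The pullback `f^* η` of a form along a map. -/
def Form.pullback {k : ℕ} (f : M → N) (η : Form F N k) : Form E M k := fun x =>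
  (η (f x)).compContinuousLinearMap (mfderiv 𝓘(ℝ, E) 𝓘(ℝ, F) f x)

/-- The expression of a form in the preferred chart at `x₀`: the pullback of `η` along the
inverse of the chart, a form on (an open subset of) the model space `E`. -/
def Form.inChart {k : ℕ} (η : Form E M k) (x₀ : M) : E → E [⋀^Fin k]→L[ℝ] ℝ :=
  Form.pullback (extChartAt 𝓘(ℝ, E) x₀).symm η

/-- A form is smooth if its expression in the preferred chart at every point is (these charts form an
atlas). -/
def Form.IsSmooth {k : ℕ} (η : Form E M k) : Prop :=
  ∀ x₀ : M, ContDiffOn ℝ ∞ (η.inChart x₀) (extChartAt 𝓘(ℝ, E) x₀).target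

/-- The exterior derivative of a form: at `x`, it is computed in the chart at `x` and pulled
back to `M`. Normalization: `dα(X, Y) = X α(Y) - Y α(X) - α([X, Y])`. -/
def Form.d {k : ℕ} (η : Form E M k) : Form E M (k + 1) := fun x =>
  (extDeriv (η.inChart x) (extChartAt 𝓘(ℝ, E) x x)).compContinuousLinearMap
    (mfderiv 𝓘(ℝ, E) 𝓘(ℝ, E) (extChartAt 𝓘(ℝ, E) x) x)

/-- A form on a group is left invariant if `L_g^* η = η` for all `g`. -/
def Form.IsLeftInvariant {k : ℕ} [Mul M] (η : Form E M k) : Prop :=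
  ∀ g : M, η.pullback (g * ·) = η

/-- A contact form: a smooth `1`-form `α` on a manifold of dimension `2p + 1` such that
`α ∧ (dα)^p` vanishes nowhere. -/
def Form.IsContact (α : Form E M 1) : Prop :=
  α.IsSmooth ∧ ∃ p : ℕ, Module.finrank ℝ E = 2 * p + 1 ∧
    ∀ x : M, wedge (α x).toAlternatingMap (wedgePow (α.d x).toAlternatingMap p) ≠ 0

/-- A symplectic form: a smooth closed nondegenerate `2`-form. -/
def Form.IsSymplectic (Ω : Form E M 2) : Prop :=
  Ω.IsSmooth ∧ Ω.d = 0 ∧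
    ∀ (x : M) (u : TangentSpace 𝓘(ℝ, E) x),
      (∀ v : TangentSpace 𝓘(ℝ, E) x, Ω x ![u, v] = 0) → u = 0

end Forms



/-- A manifold structure on the topological group `G ⧸ N` (with the quotient topology) is that of
the quotient Lie group if it makes `G ⧸ N` a Lie group and the canonical projection
`π : G → G ⧸ N` a smooth submersion. There is at most one such smooth structure. -/
structure IsQuotientLieGroup (E : Type*) [NormedAddCommGroup E] [NormedSpace ℝ E]
    (F : Type*) [NormedAddCommGroup F] [NormedSpace ℝ F]
    {G : Type*} [TopologicalSpace G] [ChartedSpace E G] [Group G]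
    (N : Subgroup G) [N.Normal] [ChartedSpace F (G ⧸ N)] : Prop where
  lieGroup : LieGroup 𝓘(ℝ, F) ∞ (G ⧸ N)
  contMDiff_mk : ContMDiff 𝓘(ℝ, E) 𝓘(ℝ, F) ∞ (QuotientGroup.mk : G → G ⧸ N)
  surjective_mfderiv_mk : ∀ g : G,
    Function.Surjective (mfderiv 𝓘(ℝ, E) 𝓘(ℝ, F) (QuotientGroup.mk : G → G ⧸ N) g)


/-- The bracket of the central extension `ℝ ×_η L` of a Lie algebra `L` by `ℝ` via a `2`-cocycle
`η`: on the vector space `ℝ × L`, `[(s, a), (t, b)] = (η(a, b), [a, b])`. -/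
def centralExtensionBracket {L : Type*} [Bracket L L] (η : L → L → ℝ) (x y : ℝ × L) : ℝ × L :=
  (η x.2 y.2, ⁅x.2, y.2⁆)

end ContactLie

end

noncomputable section

namespace ContactLie

/-! ### Exterior algebra: symplectic families and nonvanishing of a ∧ b^p. -/

section LinearAlgebra

variable {V : Type*} [AddCommGroup V] [Module ℝ V]

/-! For (a), let Θ(g) = (R_g^* α)_1, a smooth map from G to the 1-forms on L(G)
(`coadjointOrbitMap`). Left invariance of α makes Θ invariant under right translation by the center.
Since left and right invariant vector fields commute, the derivative of Θ at the identity is u ↦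
dα(u, ·) (`tderiv_coadjointOrbitMap`). The contact condition says that the kernel of dα at the
identity is a line on which α does not vanish (`ker_of_wedge_wedgePow_ne_zero`). Projecting Θ onto
the image of its derivative gives a map f, submersive at 1, whose fiber through 1 is locally a curve
containing all central elements near 1.

A closed non-discrete subgroup confined to such a curve contains the whole curve near 1
(`curve_mem_subgroup`). This elementary argument takes the place of the closed subgroup theorem. It
follows that near 1 the fibers of f lie in cosets of the center, so f induces a chart of G/Z(G) at
the identity (`exists_quotientChart`), and left translation supplies the other charts. The kernel of
dπ at 1 is then exactly the line ker dα, so -dα descends to a nondegenerate left invariant form.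
That form is closed because pullback by a surjective submersion is injective on forms
(`exists_symplectic`).

For (b), α is the left invariant extension of the first coordinate of ℝ × L(K). The formula dα(u, v)
= -α([u, v]) and the bracket of the extension give -dα = π^*ω at once. For the contact condition, α
∧ (dα)^p is evaluated on (1, 0) followed by a lifted symplectic family. In the expansion over
permutations no term is negative and the identity contributes a positive one
(`wedge_wedgePow_ne_zero`). -/

theorem factorial_smul_wedge_apply {k l : ℕ} (a : V [⋀^Fin k]→ₗ[ℝ] ℝ) (b : V [⋀^Fin l]→ₗ[ℝ] ℝ)
    (v : Fin (k + l) → V) :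
    (k.factorial * l.factorial) • wedge a b v =
      ∑ σ : Equiv.Perm (Fin k ⊕ Fin l), Equiv.Perm.sign σ •
        (a (fun i => v (finSumFinEquiv (σ (Sum.inl i)))) *
          b (fun i => v (finSumFinEquiv (σ (Sum.inr i))))) := by
  have h := MultilinearMap.domCoprod_alternization_eq a b
  have h2 := congrArg (fun f => (LinearMap.mul' ℝ ℝ) (f (v ∘ finSumFinEquiv))) h
  simp only [Fintype.card_fin] at h2
  rw [MultilinearMap.alternatization_apply] at h2
  have h3 : (LinearMap.mul' ℝ ℝ) (((k.factorial * l.factorial) • a.domCoprod b)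
      (v ∘ finSumFinEquiv)) = (k.factorial * l.factorial) • wedge a b v := by
    rw [AlternatingMap.smul_apply, map_nsmul]
    rfl
  rw [← h3, ← h2, map_sum]
  refine Finset.sum_congr rfl fun σ _ => ?_
  rw [Units.smul_def, map_zsmul]
  simp [MultilinearMap.domDomCongr_apply, MultilinearMap.domCoprod_apply, Units.smul_def]

/-- Each permutation sends u into the arguments of one of the two factors, and that factor vanishes.
The case of interest is u in the kernels of both α and dα. -/
theorem wedge_apply_eq_zero_of_mem {k l : ℕ} {a : V [⋀^Fin k]→ₗ[ℝ] ℝ} {b : V [⋀^Fin l]→ₗ[ℝ] ℝ}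
    {u : V} (ha : ∀ w : Fin k → V, (∃ i, w i = u) → a w = 0)
    (hb : ∀ w : Fin l → V, (∃ i, w i = u) → b w = 0)
    (v : Fin (k + l) → V) (hv : ∃ i, v i = u) : wedge a b v = 0 := by
  have h := factorial_smul_wedge_apply a b v
  rw [Finset.sum_eq_zero] at h
  · exact (smul_eq_zero.mp h).resolve_left
      (Nat.mul_pos k.factorial_pos l.factorial_pos).ne'
  · intro σ _
    obtain ⟨i, hi⟩ := hv
    obtain ⟨j, rfl⟩ := finSumFinEquiv.surjective i
    obtain ⟨j, rfl⟩ := σ.surjective j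
    rcases j with j | j
    · rw [ha _ ⟨j, hi⟩]; simp
    · rw [hb _ ⟨j, hi⟩]; simp

theorem wedgePow_apply_eq_zero_of_mem {b : V [⋀^Fin 2]→ₗ[ℝ] ℝ}
    {u : V} (hb : ∀ w : Fin 2 → V, (∃ i, w i = u) → b w = 0) (p : ℕ) :
    ∀ v : Fin (2 * p) → V, (∃ i, v i = u) → wedgePow b p v = 0 := by
  induction p with
  | zero => rintro v ⟨i, -⟩; exact i.elim0
  | succ p ih => exact fun v hv => wedge_apply_eq_zero_of_mem ih hb v hv

/-- A vector in the kernel of every tuple containing it kills a top degree form. -/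
theorem eq_zero_of_top_degree [FiniteDimensional ℝ V] {n : ℕ} (hn : Module.finrank ℝ V = n)
    {u : V} (hu : u ≠ 0) (f : V [⋀^Fin n]→ₗ[ℝ] ℝ)
    (hf : ∀ v : Fin n → V, (∃ i, v i = u) → f v = 0) : f = 0 := by
  have hli : LinearIndepOn ℝ id ({u} : Set V) := by
    simpa using LinearIndepOn.singleton (R := ℝ) (v := id) (i := u) hu
  let B := Module.Basis.extend hli
  have : Fintype (hli.extend (Set.subset_univ _)) := FiniteDimensional.fintypeBasisIndex B
  have hmem : u ∈ hli.extend (Set.subset_univ _) := hli.subset_extend _ rfl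
  refine Module.Basis.ext_alternating B fun v hv => ?_
  have hcard : Fintype.card (Fin n) = Fintype.card (hli.extend (Set.subset_univ _)) := by
    rw [Fintype.card_fin, ← hn, Module.finrank_eq_card_basis B]
  -- By cardinality an injective n-tuple of basis vectors exhausts the basis, so u occurs in it.
  obtain ⟨i, hi⟩ := ((Fintype.bijective_iff_injective_and_card v).mpr ⟨hv, hcard⟩).2 ⟨u, hmem⟩
  rw [hf _ ⟨i, by rw [hi]; exact Module.Basis.extend_apply_self hli _⟩]
  rfl

/-- The product `b(v₀, v₁) b(v₂, v₃) ⋯` as a multilinear map. -/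
def pairProd (b : V [⋀^Fin 2]→ₗ[ℝ] ℝ) : (p : ℕ) → MultilinearMap ℝ (fun _ : Fin (2 * p) => V) ℝ
  | 0 => haveI : IsEmpty (Fin (2 * 0)) := inferInstanceAs (IsEmpty (Fin 0))
      MultilinearMap.constOfIsEmpty ℝ _ 1
  | p + 1 => ((LinearMap.mul' ℝ ℝ).compMultilinearMap
      ((pairProd b p).domCoprod (b : MultilinearMap ℝ (fun _ : Fin 2 => V) ℝ))).domDomCongr
        finSumFinEquiv

theorem alternatization_domDomCongr' {ι ι' : Type*} [Fintype ι] [DecidableEq ι] [Fintype ι']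
    [DecidableEq ι'] (e : ι ≃ ι') (f : MultilinearMap ℝ (fun _ : ι => V) ℝ) :
    MultilinearMap.alternatization (f.domDomCongr e) =
      (MultilinearMap.alternatization f).domDomCongr e := by
  ext v
  rw [MultilinearMap.alternatization_apply, AlternatingMap.domDomCongr_apply,
    MultilinearMap.alternatization_apply]
  refine Fintype.sum_equiv (Equiv.permCongr e.symm) _ _ fun σ => ?_
  simp [MultilinearMap.domDomCongr_apply]

/-- Turns the recursive exterior power into a signed sum over all permutations of a plain product.
Alternatizing the already alternating b multiplies it by 2!, once per factor, whence 2^p. -/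
theorem alternatization_pairProd (b : V [⋀^Fin 2]→ₗ[ℝ] ℝ) (p : ℕ) :
    MultilinearMap.alternatization (pairProd b p) = (2 ^ p : ℕ) • wedgePow b p := by
  induction p with
  | zero =>
    ext v
    have : IsEmpty (Fin (2 * 0)) := inferInstanceAs (IsEmpty (Fin 0))
    rw [MultilinearMap.alternatization_apply]
    simp [pairProd, wedgePow]
  | succ p ih =>
    have : MultilinearMap.alternatization (pairProd b (p + 1)) =
      (MultilinearMap.alternatization ((LinearMap.mul' ℝ ℝ).compMultilinearMap
      ((pairProd b p).domCoprod (b : MultilinearMap ℝ (fun _ : Fin 2 => V) ℝ)))).domDomCongr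
        finSumFinEquiv := alternatization_domDomCongr' _ _
    rw [this, LinearMap.compMultilinearMap_alternatization,
      MultilinearMap.domCoprod_alternization, ih, AlternatingMap.coe_alternatization,
      ← AlternatingMap.domCoprod'_apply, ← TensorProduct.smul_tmul', TensorProduct.tmul_smul,
      LinearMap.map_smul_of_tower AlternatingMap.domCoprod',
      LinearMap.map_smul_of_tower AlternatingMap.domCoprod']
    ext v
    simp only [Fintype.card_fin, Nat.factorial_two, AlternatingMap.domDomCongr_apply,
      LinearMap.compAlternatingMap_apply, AlternatingMap.smul_apply, map_nsmul, smul_smul,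
      pow_succ]
    rfl

/-- The position `2 i + j` of the `j`-th vector of the `i`-th pair. -/
def pairEquiv (p : ℕ) : Fin p × Fin 2 ≃ Fin (2 * p) :=
  finProdFinEquiv.trans (finCongr (mul_comm p 2))

theorem pairProd_apply (b : V [⋀^Fin 2]→ₗ[ℝ] ℝ) (p : ℕ) (v : Fin (2 * p) → V) :
    pairProd b p v = ∏ i : Fin p, b (fun j => v (pairEquiv p (i, j))) := by
  induction p with
  | zero => simp [pairProd]
  | succ p ih =>
    have h : pairProd b (p + 1) v =
      pairProd b p (fun i => v (finSumFinEquiv (Sum.inl i) : Fin (2 * p + 2))) *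
        b (fun i => v (finSumFinEquiv (Sum.inr i) : Fin (2 * p + 2))) := rfl
    rw [h, ih, Fin.prod_univ_castSucc]
    congr 1
    refine congrArg b (funext fun j => congrArg v (Fin.ext ?_))
    simp [pairEquiv, finProdFinEquiv]
    ring

/-- A symplectic family for the alternating form `b`. -/
def IsSymplecticFamily (b : V [⋀^Fin 2]→ₗ[ℝ] ℝ) {p : ℕ} (v : Fin p × Fin 2 → V) : Prop :=
  (∀ i, b ![v (i, 0), v (i, 1)] = 1) ∧ ∀ i j r s, i ≠ j → b ![v (i, r), v (j, s)] = 0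

theorem IsSymplecticFamily.apply_perm {b : V [⋀^Fin 2]→ₗ[ℝ] ℝ} {p : ℕ} {v : Fin p × Fin 2 → V}
    (h : IsSymplecticFamily b v) (i : Fin p) (ρ : Equiv.Perm (Fin 2)) :
    b (fun j => v (i, ρ j)) = Equiv.Perm.sign ρ := by
  have := b.map_perm (fun j => v (i, j)) ρ
  have h1 : b (fun j => v (i, j)) = 1 := by
    rw [← h.1 i]; congr 1; ext j; fin_cases j <;> rfl
  rw [h1] at this
  simpa [Units.smul_def, Function.comp_def] using this

/-- A permutation that separates some pair gives a zero factor. Any other permutes the pairs as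
blocks and acts inside each block, and then the sign cancels against the product of the values of b.
-/
theorem sign_smul_prod_nonneg {b : V [⋀^Fin 2]→ₗ[ℝ] ℝ} {p : ℕ} {v : Fin p × Fin 2 → V}
    (h : IsSymplecticFamily b v) (σ : Equiv.Perm (Fin p × Fin 2)) :
    0 ≤ Equiv.Perm.sign σ • ∏ i : Fin p, b (fun j => v (σ (i, j))) := by
  by_cases h0 : ∃ i, (σ (i, 0)).1 ≠ (σ (i, 1)).1
  · obtain ⟨i, hi⟩ := h0
    rw [Finset.prod_eq_zero (Finset.mem_univ i)]
    · simp
    · have := h.2 (σ (i, 0)).1 (σ (i, 1)).1 (σ (i, 0)).2 (σ (i, 1)).2 hi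
      rw [← this]; congr 1; ext j; fin_cases j <;> rfl
  push Not at h0
  have h1 : ∀ i j, (σ (i, j)).1 = (σ (i, 0)).1 := by
    intro i j; fin_cases j
    · rfl
    · exact (h0 i).symm
  have hsurj : Function.Surjective fun i => (σ (i, 0)).1 := fun k => by
    obtain ⟨⟨i, j⟩, hij⟩ := σ.surjective (k, 0)
    exact ⟨i, by simp only [← h1 i j, hij]⟩
  let τ : Equiv.Perm (Fin p) := Equiv.ofBijective _ (Finite.injective_iff_bijective.mp
    (Finite.injective_iff_surjective.mpr hsurj))
  have hρ : ∀ i, Function.Bijective fun j => (σ (i, j)).2 := fun i => by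
    refine Finite.injective_iff_bijective.mp fun j k hjk => ?_
    have : σ (i, j) = σ (i, k) := Prod.ext ((h1 i j).trans (h1 i k).symm) hjk
    simpa using σ.injective this
  let ρ : Fin p → Equiv.Perm (Fin 2) := fun i => Equiv.ofBijective _ (hρ i)
  have hσ : σ = Equiv.prodCongrLeft (fun _ : Fin 2 => τ) * Equiv.prodCongrRight ρ := by
    ext1 ⟨i, j⟩
    exact Prod.ext (h1 i j) rfl
  -- The block permutation τ acts once on each of the two columns, so it contributes the square of
  -- its sign.
  have hs : Equiv.Perm.sign σ = ∏ i, Equiv.Perm.sign (ρ i) := by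
    rw [hσ, Equiv.Perm.sign_mul, Equiv.Perm.sign_prodCongrLeft, Equiv.Perm.sign_prodCongrRight]
    simp
  have hb : ∀ i, b (fun j => v (σ (i, j))) = Equiv.Perm.sign (ρ i) := fun i => by
    rw [← h.apply_perm (τ i) (ρ i)]
    congr 1; ext j
    rw [hσ]; rfl
  simp_rw [hb, hs, Units.smul_def]
  rw [zsmul_eq_mul]
  push_cast
  rw [← Finset.prod_mul_distrib]
  exact Finset.prod_nonneg fun i _ => mul_self_nonneg _

/-- No term of the permutation sum is negative and the identity contributes 1, so positivity follows
without computing the exact value. -/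
theorem wedgePow_pos {b : V [⋀^Fin 2]→ₗ[ℝ] ℝ} {p : ℕ} {v : Fin p × Fin 2 → V}
    (h : IsSymplecticFamily b v) : 0 < wedgePow b p (v ∘ (pairEquiv p).symm) := by
  have h1 := congrArg (fun f => f (v ∘ (pairEquiv p).symm)) (alternatization_pairProd b p)
  simp only [MultilinearMap.alternatization_apply, AlternatingMap.smul_apply] at h1
  have h2 : 0 < ∑ σ : Equiv.Perm (Fin (2 * p)), Equiv.Perm.sign σ •
      (pairProd b p).domDomCongr σ (v ∘ (pairEquiv p).symm) := by
    refine Finset.sum_pos' (fun σ _ => ?_) ⟨1, Finset.mem_univ _, ?_⟩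
    · have := sign_smul_prod_nonneg h (Equiv.permCongr (pairEquiv p).symm σ)
      simpa [pairProd_apply] using this
    · have : ∀ i, b (fun j => v (i, j)) = 1 := fun i => by simpa using h.apply_perm i 1
      simp [pairProd_apply, this]
  rw [h1, nsmul_eq_mul] at h2
  exact pos_of_mul_pos_right h2 (by positivity)

/-- Evaluate on ξ followed by the family: only permutations keeping ξ in the slot of a survive, and
all of them contribute the same positive number. -/
theorem wedge_wedgePow_ne_zero {a : V [⋀^Fin 1]→ₗ[ℝ] ℝ} {b : V [⋀^Fin 2]→ₗ[ℝ] ℝ} {p : ℕ}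
    {v : Fin p × Fin 2 → V} (h : IsSymplecticFamily b v) {ξ : V} (hξ : a ![ξ] = 1)
    (hv : ∀ i, a ![v i] = 0) : wedge a (wedgePow b p) ≠ 0 := by
  intro h0
  let w : Fin 1 ⊕ Fin (2 * p) → V := Sum.elim (fun _ => ξ) (v ∘ (pairEquiv p).symm)
  have h1 := factorial_smul_wedge_apply a (wedgePow b p) (w ∘ finSumFinEquiv.symm)
  rw [h0] at h1
  simp only [AlternatingMap.zero_apply, smul_zero, Function.comp_apply,
    Equiv.symm_apply_apply] at h1
  have hpos := wedgePow_pos h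
  have key : ∀ x, a (fun _ => x) = a ![x] := fun x => by
    congr 1; ext i; fin_cases i; rfl
  have key' : ∀ f : Fin 1 → V, a f = a ![f 0] := fun f => by
    congr 1; ext i; fin_cases i; rfl
  refine h1.not_lt (Finset.sum_pos' (fun σ _ => ?_) ⟨1, Finset.mem_univ _, ?_⟩)
  · rcases hσ : σ (Sum.inl 0) with i | j
    -- Such a permutation preserves both blocks, and its sign appears twice: in front and from
    -- reordering the arguments of the exterior power.
    · have : σ ∈ (Equiv.Perm.sumCongrHom (Fin 1) (Fin (2 * p))).range := by
        refine Equiv.Perm.mem_sumCongrHom_range_of_perm_mapsTo_inl ?_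
        rintro _ ⟨k, rfl⟩
        exact ⟨i, by rw [← hσ, Subsingleton.elim k 0]⟩
      obtain ⟨⟨σ₁, σ₂⟩, rfl⟩ := this
      have h2 := (wedgePow b p).map_perm (v ∘ (pairEquiv p).symm) σ₂
      have h3 : Equiv.Perm.sign σ₁ = 1 := by rw [Subsingleton.elim σ₁ 1]; simp
      have h4 : wedgePow b p (fun i => w (Sum.inr (σ₂ i))) =
        Equiv.Perm.sign σ₂ • wedgePow b p (v ∘ (pairEquiv p).symm) := h2
      simp only [Equiv.Perm.sumCongrHom_apply, Equiv.Perm.sign_sumCongr, h3, one_mul,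
        Equiv.sumCongr_apply, Sum.map_inl, Sum.map_inr, h4]
      simp only [w, Sum.elim_inl, key, hξ, one_mul, smul_smul, Int.units_mul_self, one_smul]
      exact hpos.le
    · rw [key', hσ]
      simp [w, hv]
  · simp only [Equiv.Perm.one_apply, Equiv.Perm.sign_one, one_smul]
    simp only [w, Sum.elim_inl, Sum.elim_inr, key, hξ, one_mul]
    exact hpos

theorem map_pair_swap (b : V [⋀^Fin 2]→ₗ[ℝ] ℝ) (x y : V) : b ![y, x] = -b ![x, y] := by
  rw [← b.map_swap ![x, y] (i := 0) (j := 1) (by decide)]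
  congr 1; ext i; fin_cases i <;> rfl

/-- An alternating bilinear form as a bilinear map. -/
def toBilin (b : V [⋀^Fin 2]→ₗ[ℝ] ℝ) : V →ₗ[ℝ] V →ₗ[ℝ] ℝ :=
  LinearMap.mk₂ ℝ (fun x y => b ![x, y])
    (fun x x' y => b.map_vecCons_add _ x x') (fun c x y => b.map_vecCons_smul _ c x)
    (fun x y y' => by
      rw [← neg_inj, ← map_pair_swap, neg_add, ← map_pair_swap, ← map_pair_swap]
      exact b.map_vecCons_add _ y y')
    (fun c x y => by
      rw [← neg_inj, ← map_pair_swap, ← smul_neg, ← map_pair_swap]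
      exact b.map_vecCons_smul _ c y)

@[simp] theorem toBilin_apply (b : V [⋀^Fin 2]→ₗ[ℝ] ℝ) (x y : V) : toBilin b x y = b ![x, y] := rfl

theorem map_pair_self (b : V [⋀^Fin 2]→ₗ[ℝ] ℝ) (x : V) : b ![x, x] = 0 :=
  b.map_eq_zero_of_eq ![x, x] (i := 0) (j := 1) rfl Fin.zero_ne_one

/-- Symplectic Gram–Schmidt: split off a hyperbolic plane spanned by x, y with b(x, y) = 1. Its
orthogonal complement W has codimension 2 and b stays nondegenerate there, so induction applies. -/
theorem exists_symplecticFamily_aux (n : ℕ) : ∀ (V : Type*) [AddCommGroup V] [Module ℝ V]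
    [FiniteDimensional ℝ V] (b : V [⋀^Fin 2]→ₗ[ℝ] ℝ),
    Module.finrank ℝ V = n → (∀ u, (∀ v, b ![u, v] = 0) → u = 0) →
    ∃ (p : ℕ) (v : Fin p × Fin 2 → V), n = 2 * p ∧ IsSymplecticFamily b v := by
  induction n using Nat.strong_induction_on with
  | _ n ih =>
    intro V _ _ _ b hn hb
    rcases Nat.eq_zero_or_pos n with rfl | hpos
    · exact ⟨0, fun i => i.1.elim0, rfl, fun i => i.elim0, fun i => i.elim0⟩
    have : Nontrivial V := Module.finrank_pos_iff.mp (hn ▸ hpos)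
    obtain ⟨x, hx⟩ := exists_ne (0 : V)
    obtain ⟨y', hy'⟩ : ∃ y, b ![x, y] ≠ 0 := by
      by_contra! h
      exact hx (hb x h)
    obtain ⟨y, hy⟩ : ∃ y, b ![x, y] = 1 := by
      refine ⟨(b ![x, y'])⁻¹ • y', ?_⟩
      rw [← toBilin_apply, map_smul, toBilin_apply, smul_eq_mul, inv_mul_cancel₀ hy']
    have hyx : b ![y, x] = -1 := by rw [map_pair_swap, hy]
    let T : V →ₗ[ℝ] ℝ × ℝ := ((toBilin b).flip x).prod ((toBilin b).flip y)
    have hT : ∀ z, T z = (b ![z, x], b ![z, y]) := fun z => rfl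
    have hTsurj : Function.Surjective T := by
      rintro ⟨r, s⟩
      refine ⟨s • x - r • y, ?_⟩
      rw [map_sub, map_smul, map_smul, hT, hT, map_pair_self, map_pair_self, hy, hyx]
      simp
    have hrank := LinearMap.finrank_range_add_finrank_ker T
    rw [LinearMap.range_eq_top.mpr hTsurj, finrank_top, hn] at hrank
    simp only [Module.finrank_prod, Module.finrank_self] at hrank
    let W := LinearMap.ker T
    have hrankW : 1 + 1 + Module.finrank ℝ W = n := hrank
    have hW : ∀ w : W, b ![(w : V), x] = 0 ∧ b ![(w : V), y] = 0 := fun w => by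
      have := w.2
      rw [LinearMap.mem_ker, hT] at this
      exact ⟨congrArg Prod.fst this, congrArg Prod.snd this⟩
    let b' : W [⋀^Fin 2]→ₗ[ℝ] ℝ := b.compLinearMap W.subtype
    have hb' : ∀ u v : W, b' ![u, v] = b ![(u : V), v] := fun u v => by
      simp only [b', AlternatingMap.compLinearMap_apply]
      congr 1; ext i; fin_cases i <;> rfl
    obtain ⟨p, v, hp, hv⟩ := ih (Module.finrank ℝ W) (by omega) W b' rfl (fun u hu => by
      refine Subtype.ext (hb u fun z => ?_)
      -- The subtracted vector is the component of z along the plane. It is orthogonal to u ∈ W, so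
      -- testing u against W is as good as testing it against V.
      have hz : z - (b ![z, y] • x - b ![z, x] • y) ∈ W := by
        rw [LinearMap.mem_ker, map_sub, map_sub, map_smul, map_smul, hT, hT, hT, map_pair_self,
          map_pair_self, hy, hyx]
        simp
      have h1 := hu ⟨_, hz⟩
      rw [hb'] at h1
      simp only [← toBilin_apply, map_sub, map_smul] at h1
      simp only [toBilin_apply, (hW u).1, (hW u).2] at h1
      simpa using h1)
    refine ⟨p + 1, fun i => Fin.cases (![x, y] i.2) (fun k => (v (k, i.2) : V)) i.1, by omega, ?_, ?_⟩
    · intro i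
      refine Fin.cases ?_ (fun k => ?_) i
      · simpa using hy
      · simpa [hb'] using hv.1 k
    · intro i j r s
      have hxy : ∀ (w : W) (s : Fin 2), b ![(w : V), ![x, y] s] = 0 := fun w s => by
        fin_cases s
        · exact (hW w).1
        · exact (hW w).2
      refine Fin.cases ?_ (fun k => ?_) i <;> refine Fin.cases ?_ (fun l => ?_) j
      · simp
      · intro _
        rw [map_pair_swap]
        simpa using hxy (v (l, s)) r
      · intro _
        simpa using hxy (v (k, r)) s
      · intro hkl
        simpa [hb'] using hv.2 k l r s (by simpa using hkl)

theorem exists_symplecticFamily [FiniteDimensional ℝ V] (b : V [⋀^Fin 2]→ₗ[ℝ] ℝ)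
    (hb : ∀ u, (∀ v, b ![u, v] = 0) → u = 0) :
    ∃ (p : ℕ) (v : Fin p × Fin 2 → V), Module.finrank ℝ V = 2 * p ∧ IsSymplecticFamily b v :=
  exists_symplecticFamily_aux _ V b rfl hb

/-- Linear algebra of a contact form at a point: the kernel of `b` is a line on which `a` does not
vanish. -/
theorem ker_of_wedge_wedgePow_ne_zero [FiniteDimensional ℝ V] {p : ℕ}
    (hV : Module.finrank ℝ V = 2 * p + 1) {a : V [⋀^Fin 1]→ₗ[ℝ] ℝ} {b : V [⋀^Fin 2]→ₗ[ℝ] ℝ}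
    (h : wedge a (wedgePow b p) ≠ 0) :
    (∀ u, a ![u] = 0 → (∀ v, b ![u, v] = 0) → u = 0) ∧
      Module.finrank ℝ (LinearMap.ker (toBilin b)) = 1 := by
  have h1 : ∀ u, a ![u] = 0 → (∀ v, b ![u, v] = 0) → u = 0 := by
    intro u ha hb
    by_contra hu
    refine h (eq_zero_of_top_degree (by rw [hV]; ring) hu _ ?_)
    refine wedge_apply_eq_zero_of_mem ?_ (wedgePow_apply_eq_zero_of_mem ?_ p)
    · rintro w ⟨i, hi⟩
      rw [← ha]; congr 1; ext j
      rw [← hi, Subsingleton.elim i 0, Subsingleton.elim j 0]; rfl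
    · rintro w ⟨i, hi⟩
      have hw : w = ![w 0, w 1] := by ext j; fin_cases j <;> rfl
      rw [hw]
      fin_cases i
      · exact hi ▸ hb (w 1)
      · rw [map_pair_swap]; exact neg_eq_zero.mpr (hi ▸ hb (w 0))
  refine ⟨h1, ?_⟩
  let A : LinearMap.ker (toBilin b) →ₗ[ℝ] ℝ :=
    { toFun := fun u => a ![(u : V)]
      map_add' := fun x y => a.map_vecCons_add _ _ _
      map_smul' := fun c x => a.map_vecCons_smul _ _ _ }
  have hinj : Function.Injective A := by
    refine (injective_iff_map_eq_zero _).mpr fun u hu => Subtype.ext (h1 u hu fun v => ?_)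
    have := u.2
    rw [LinearMap.mem_ker] at this
    exact congrArg (fun f => f v) this
  have hle : Module.finrank ℝ (LinearMap.ker (toBilin b)) ≤ 1 := by
    simpa using LinearMap.finrank_le_finrank_of_injective hinj
  -- A trivial kernel would make b nondegenerate and hence the dimension even, but it is 2p + 1.
  refine le_antisymm hle (Nat.one_le_iff_ne_zero.mpr fun h0 => ?_)
  have hbot : LinearMap.ker (toBilin b) = ⊥ := Submodule.finrank_eq_zero.mp h0
  obtain ⟨q, -, hq, -⟩ := exists_symplecticFamily b fun u hu => by
    have : u ∈ LinearMap.ker (toBilin b) := by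
      rw [LinearMap.mem_ker]; ext v; simpa using hu v
    rwa [hbot, Submodule.mem_bot] at this
  omega

end LinearAlgebra

theorem minSmoothness_two_le_infty : minSmoothness ℝ 2 ≤ (∞ : WithTop ℕ∞) := by
  rw [minSmoothness_of_isRCLikeNormedField]
  exact WithTop.coe_le_coe.mpr le_top

/-! ### Smooth dependence of the pullback of an alternating form on a linear map. -/

section AlternatingComp

variable {E : Type*} [NormedAddCommGroup E] [NormedSpace ℝ E] [FiniteDimensional ℝ E]
  {F : Type*} [NormedAddCommGroup F] [NormedSpace ℝ F]
  {X : Type*} [NormedAddCommGroup X] [NormedSpace ℝ X]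

/-- For plain multilinear maps the operation is smooth, being continuous multilinear in the linear
maps and linear in the form. Finite dimension provides a continuous linear left inverse of the
inclusion of alternating into multilinear maps, which carries smoothness back. -/
theorem contDiffAt_compContinuousLinearMap {k : ℕ} {n : WithTop ℕ∞} {θ : X → F [⋀^Fin k]→L[ℝ] ℝ}
    {g : X → E →L[ℝ] F} {x : X} (hθ : ContDiffAt ℝ n θ x) (hg : ContDiffAt ℝ n g x) :
    ContDiffAt ℝ n (fun y => (θ y).compContinuousLinearMap (g y)) x := by
  let T : (E [⋀^Fin k]→L[ℝ] ℝ) →L[ℝ] ContinuousMultilinearMap ℝ (fun _ : Fin k => E) ℝ :=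
    ContinuousAlternatingMap.toContinuousMultilinearMapCLM ℝ
  have hfd : FiniteDimensional ℝ (ContinuousMultilinearMap ℝ (fun _ : Fin k => E) ℝ) :=
    Module.Finite.of_injective (ContinuousMultilinearMap.toMultilinearMapLinear :
        ContinuousMultilinearMap ℝ (fun _ : Fin k => E) ℝ →ₗ[ℝ] _)
      ContinuousMultilinearMap.toMultilinearMap_injective
  obtain ⟨S, hS⟩ := T.toLinearMap.exists_leftInverse_of_injective
    (LinearMap.ker_eq_bot.mpr ContinuousAlternatingMap.toContinuousMultilinearMap_injective)
  let S' := LinearMap.toContinuousLinearMap S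
  have h1 : (fun y => (θ y).compContinuousLinearMap (g y)) = fun y =>
      S' ((ContinuousMultilinearMap.compContinuousLinearMapContinuousMultilinear ℝ
        (fun _ : Fin k => E) (fun _ => F) ℝ (fun _ => g y))
        (ContinuousAlternatingMap.toContinuousMultilinearMapCLM ℝ (θ y))) := by
    funext y
    exact (congrArg (fun f => f ((θ y).compContinuousLinearMap (g y))) hS).symm
  rw [h1]
  refine S'.contDiff.contDiffAt.comp x (ContDiffAt.clm_apply ?_ ?_)
  · exact ((ContinuousMultilinearMap.contDiff _).contDiffAt).comp x
      (contDiffAt_pi.mpr fun _ => hg)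
  · exact (ContinuousLinearMap.contDiff _).contDiffAt.comp x hθ

end AlternatingComp

open Filter Topology

set_option linter.unusedSectionVars false

/-! ### Derivatives of maps between manifolds, read on the model spaces. -/

section TDeriv

variable {E : Type*} [NormedAddCommGroup E] [NormedSpace ℝ E]
  {M : Type*} [TopologicalSpace M] [ChartedSpace E M]
  {F : Type*} [NormedAddCommGroup F] [NormedSpace ℝ F]
  {N : Type*} [TopologicalSpace N] [ChartedSpace F N]
  {F' : Type*} [NormedAddCommGroup F'] [NormedSpace ℝ F']
  {N' : Type*} [TopologicalSpace N'] [ChartedSpace F' N']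

/-- The derivative of a map between manifolds, as a map between the model spaces. -/
def tderiv (E F : Type*) [NormedAddCommGroup E] [NormedSpace ℝ E] [NormedAddCommGroup F]
    [NormedSpace ℝ F] {M N : Type*} [TopologicalSpace M] [ChartedSpace E M]
    [TopologicalSpace N] [ChartedSpace F N] (f : M → N) (x : M) : E →L[ℝ] F := mfderiv 𝓘(ℝ, E) 𝓘(ℝ, F) f x

/-- The value of a form at a point, as a form on the model space. -/
def Form.val {k : ℕ} (η : Form E M k) (x : M) : E [⋀^Fin k]→L[ℝ] ℝ := η x

theorem Form.ext_val {k : ℕ} {η θ : Form E M k} (h : ∀ x, η.val x = θ.val x) : η = θ := funext h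

theorem Form.val_pullback {k : ℕ} (f : M → N) (η : Form F N k) (x : M) :
    (η.pullback f : Form E M k).val x = (η.val (f x)).compContinuousLinearMap (tderiv E F f x) := rfl

theorem Form.inChart_apply {k : ℕ} (η : Form E M k) (x₀ : M) (y : E) :
    η.inChart x₀ y = (η.val ((extChartAt 𝓘(ℝ, E) x₀).symm y)).compContinuousLinearMap
      (tderiv E E (extChartAt 𝓘(ℝ, E) x₀).symm y) := rfl

theorem Form.val_d {k : ℕ} (η : Form E M k) (x : M) :
    η.d.val x = (extDeriv (η.inChart x) (extChartAt 𝓘(ℝ, E) x x)).compContinuousLinearMap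
      (tderiv E E (extChartAt 𝓘(ℝ, E) x) x) := rfl

theorem tderiv_comp {g : N → N'} {f : M → N} {x : M}
    (hg : MDifferentiableAt 𝓘(ℝ, F) 𝓘(ℝ, F') g (f x))
    (hf : MDifferentiableAt 𝓘(ℝ, E) 𝓘(ℝ, F) f x) :
    tderiv E F' (g ∘ f) x = (tderiv F F' g (f x)).comp (tderiv E F f x) := mfderiv_comp x hg hf

theorem tderiv_congr {f g : M → N} {x : M} (h : f =ᶠ[𝓝 x] g) : tderiv E F f x = tderiv E F g x :=
  h.mfderiv_eq

theorem tderiv_id (x : M) : tderiv E E (id : M → M) x = ContinuousLinearMap.id ℝ E := mfderiv_id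

theorem tderiv_eq_fderiv (f : E → F) (x : E) : tderiv E F f x = fderiv ℝ f x := mfderiv_eq_fderiv

theorem mdifferentiableAt_of_contMDiffAt {f : M → N} {x : M}
    (hf : ContMDiffAt 𝓘(ℝ, E) 𝓘(ℝ, F) ∞ f x) : MDifferentiableAt 𝓘(ℝ, E) 𝓘(ℝ, F) f x :=
  hf.mdifferentiableAt (by simp)

variable [IsManifold 𝓘(ℝ, E) ∞ M] [IsManifold 𝓘(ℝ, F) ∞ N]

theorem eventually_mdifferentiableAt {f : M → N} {x : M}
    (hf : ContMDiffAt 𝓘(ℝ, E) 𝓘(ℝ, F) ∞ f x) :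
    ∀ᶠ z in 𝓝 x, MDifferentiableAt 𝓘(ℝ, E) 𝓘(ℝ, F) f z := by
  have : IsManifold 𝓘(ℝ, E) 1 M := .of_le (n := ∞) (by simp)
  have : IsManifold 𝓘(ℝ, F) 1 N := .of_le (n := ∞) (by simp)
  have h1 : ContMDiffAt 𝓘(ℝ, E) 𝓘(ℝ, F) 1 f x := hf.of_le (by simp)
  filter_upwards [(contMDiffAt_iff_contMDiffAt_nhds (by simp)).mp h1] with z hz using hz.mdifferentiableAt (by simp)

theorem contMDiffAt_extChartAt_of_mem {x₀ x : M} (hx : x ∈ (extChartAt 𝓘(ℝ, E) x₀).source) :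
    ContMDiffAt 𝓘(ℝ, E) 𝓘(ℝ, E) ∞ (extChartAt 𝓘(ℝ, E) x₀) x :=
  contMDiffAt_extChartAt' (by simpa using hx)

theorem contMDiffAt_extChartAt_symm_of_mem {x₀ : M} {y : E}
    (hy : y ∈ (extChartAt 𝓘(ℝ, E) x₀).target) :
    ContMDiffAt 𝓘(ℝ, E) 𝓘(ℝ, E) ∞ (extChartAt 𝓘(ℝ, E) x₀).symm y :=
  (contMDiffOn_extChartAt_symm x₀).contMDiffAt (extChartAt_target_mem_nhds' hy)

theorem eventually_symm_extChartAt {x₀ x : M} (hx : x ∈ (extChartAt 𝓘(ℝ, E) x₀).source) :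
    ∀ᶠ z in 𝓝 x, (extChartAt 𝓘(ℝ, E) x₀).symm (extChartAt 𝓘(ℝ, E) x₀ z) = z := by
  filter_upwards [extChartAt_source_mem_nhds' hx] with z hz
  exact (extChartAt 𝓘(ℝ, E) x₀).left_inv hz

theorem eventually_extChartAt_symm {x₀ : M} {y : E} (hy : y ∈ (extChartAt 𝓘(ℝ, E) x₀).target) :
    ∀ᶠ z in 𝓝 y, extChartAt 𝓘(ℝ, E) x₀ ((extChartAt 𝓘(ℝ, E) x₀).symm z) = z := by
  filter_upwards [extChartAt_target_mem_nhds' hy] with z hz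
  exact (extChartAt 𝓘(ℝ, E) x₀).right_inv hz

theorem tderiv_extChartAt_comp_symm {x₀ : M} {y : E} (hy : y ∈ (extChartAt 𝓘(ℝ, E) x₀).target) :
    (tderiv E E (extChartAt 𝓘(ℝ, E) x₀) ((extChartAt 𝓘(ℝ, E) x₀).symm y)).comp
      (tderiv E E (extChartAt 𝓘(ℝ, E) x₀).symm y) = ContinuousLinearMap.id ℝ E := by
  rw [← tderiv_comp, ← tderiv_id (E := E) (M := E) y]
  · exact tderiv_congr (eventually_extChartAt_symm hy)
  · exact mdifferentiableAt_of_contMDiffAt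
      (contMDiffAt_extChartAt_of_mem ((extChartAt 𝓘(ℝ, E) x₀).map_target hy))
  · exact mdifferentiableAt_of_contMDiffAt (contMDiffAt_extChartAt_symm_of_mem hy)

/-- The manifold derivative at x is computed in the preferred chart at x, where this same chart
becomes the identity map. Hence the tangent space at x needs no further identification with E. -/
theorem tderiv_extChartAt_self (x : M) :
    tderiv E E (extChartAt 𝓘(ℝ, E) x) x = ContinuousLinearMap.id ℝ E := by
  have : IsManifold 𝓘(ℝ, E) 1 M := .of_le (n := ∞) (by simp)
  have h : MDifferentiableAt 𝓘(ℝ, E) 𝓘(ℝ, E) (extChartAt 𝓘(ℝ, E) x) x :=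
    mdifferentiableAt_extChartAt (mem_chart_source E x)
  have h1 : tderiv E E (extChartAt 𝓘(ℝ, E) x) x = fderivWithin ℝ
      (writtenInExtChartAt 𝓘(ℝ, E) 𝓘(ℝ, E) x (extChartAt 𝓘(ℝ, E) x)) (Set.range 𝓘(ℝ, E))
      (extChartAt 𝓘(ℝ, E) x x) := by
    unfold tderiv mfderiv
    exact if_pos h
  rw [h1, modelWithCornersSelf_coe, Set.range_id, fderivWithin_univ]
  have h2 : writtenInExtChartAt 𝓘(ℝ, E) 𝓘(ℝ, E) x (extChartAt 𝓘(ℝ, E) x)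
      =ᶠ[𝓝 (extChartAt 𝓘(ℝ, E) x x)] id := by
    filter_upwards [eventually_extChartAt_symm (mem_extChartAt_target x)] with z hz
    exact hz
  rw [h2.fderiv_eq, fderiv_id]

end TDeriv

/-! ### Calculus of forms: naturality of d, independence of charts, d ∘ d = 0. -/

section FormCalculus

variable {E : Type*} [NormedAddCommGroup E] [NormedSpace ℝ E]
  {M : Type*} [TopologicalSpace M] [ChartedSpace E M]
  {F : Type*} [NormedAddCommGroup F] [NormedSpace ℝ F]
  {N : Type*} [TopologicalSpace N] [ChartedSpace F N]
  {F' : Type*} [NormedAddCommGroup F'] [NormedSpace ℝ F']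
  {N' : Type*} [TopologicalSpace N'] [ChartedSpace F' N']

namespace Form

theorem pullback_id {k : ℕ} (η : Form E M k) : η.pullback id = η :=
  ext_val fun x => by rw [val_pullback, tderiv_id]; rfl

theorem pullback_pullback {k : ℕ} (η : Form F' N' k) {g : N → N'} {f : M → N}
    (hg : MDifferentiable 𝓘(ℝ, F) 𝓘(ℝ, F') g) (hf : MDifferentiable 𝓘(ℝ, E) 𝓘(ℝ, F) f) :
    (η.pullback g : Form F N k).pullback f = (η.pullback (g ∘ f) : Form E M k) :=
  ext_val fun x => by
    rw [val_pullback, val_pullback, val_pullback, tderiv_comp (hg _) (hf _)]; rfl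

theorem pullback_neg {k : ℕ} (η : Form F N k) (f : M → N) :
    ((-η).pullback f : Form E M k) = -(η.pullback f) := rfl

theorem inChart_neg {k : ℕ} (η : Form E M k) (x₀ : M) : (-η).inChart x₀ = -(η.inChart x₀) := rfl

theorem d_neg {k : ℕ} (η : Form E M k) : (-η).d = -η.d :=
  ext_val fun x => by
    rw [val_d, inChart_neg, extDeriv, fderiv_neg]
    have := map_neg (ContinuousAlternatingMap.alternatizeUncurryFinCLM ℝ E ℝ)
      (fderiv ℝ (η.inChart x) (extChartAt 𝓘(ℝ, E) x x))
    exact congrArg (fun θ : E [⋀^Fin (k + 1)]→L[ℝ] ℝ => θ.compContinuousLinearMap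
      (tderiv E E (extChartAt 𝓘(ℝ, E) x) x)) this

theorem IsSmooth.contDiffAt {k : ℕ} {η : Form E M k} (h : η.IsSmooth) {x₀ : M} {y : E}
    (hy : y ∈ (extChartAt 𝓘(ℝ, E) x₀).target) : ContDiffAt ℝ ∞ (η.inChart x₀) y :=
  (h x₀).contDiffAt ((isOpen_extChartAt_target x₀).mem_nhds hy)

variable [IsManifold 𝓘(ℝ, E) ∞ M] [IsManifold 𝓘(ℝ, F) ∞ N]

theorem inChart_pullback {k : ℕ} (η : Form F N k) {f : M → N} {x₀ : M} {z₀ : N} {y : E}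
    (hy : y ∈ (extChartAt 𝓘(ℝ, E) x₀).target)
    (hf : MDifferentiableAt 𝓘(ℝ, E) 𝓘(ℝ, F) f ((extChartAt 𝓘(ℝ, E) x₀).symm y))
    (hfy : f ((extChartAt 𝓘(ℝ, E) x₀).symm y) ∈ (extChartAt 𝓘(ℝ, F) z₀).source) :
    (η.pullback f : Form E M k).inChart x₀ y =
      (η.inChart z₀ (extChartAt 𝓘(ℝ, F) z₀ (f ((extChartAt 𝓘(ℝ, E) x₀).symm y)))
        ).compContinuousLinearMap
        (fderiv ℝ (fun y => extChartAt 𝓘(ℝ, F) z₀ (f ((extChartAt 𝓘(ℝ, E) x₀).symm y))) y) := by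
  have hc := mdifferentiableAt_of_contMDiffAt (contMDiffAt_extChartAt_symm_of_mem hy)
  have hz := mdifferentiableAt_of_contMDiffAt (contMDiffAt_extChartAt_of_mem hfy)
  have hfc : MDifferentiableAt 𝓘(ℝ, E) 𝓘(ℝ, F) (f ∘ (extChartAt 𝓘(ℝ, E) x₀).symm) y :=
    hf.comp y hc
  have hφ : MDifferentiableAt 𝓘(ℝ, E) 𝓘(ℝ, F)
    (extChartAt 𝓘(ℝ, F) z₀ ∘ (f ∘ (extChartAt 𝓘(ℝ, E) x₀).symm)) y := hz.comp y hfc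
  have hzs := mdifferentiableAt_of_contMDiffAt (contMDiffAt_extChartAt_symm_of_mem
    ((extChartAt 𝓘(ℝ, F) z₀).map_source hfy))
  have key : (tderiv F F (extChartAt 𝓘(ℝ, F) z₀).symm (extChartAt 𝓘(ℝ, F) z₀
      (f ((extChartAt 𝓘(ℝ, E) x₀).symm y)))).comp (fderiv ℝ (fun y => extChartAt 𝓘(ℝ, F) z₀
      (f ((extChartAt 𝓘(ℝ, E) x₀).symm y))) y) =
      (tderiv E F f ((extChartAt 𝓘(ℝ, E) x₀).symm y)).comp
        (tderiv E E (extChartAt 𝓘(ℝ, E) x₀).symm y) := by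
    rw [← tderiv_eq_fderiv, ← tderiv_comp hf hc]
    refine (tderiv_comp (f := extChartAt 𝓘(ℝ, F) z₀ ∘ (f ∘ (extChartAt 𝓘(ℝ, E) x₀).symm))
      hzs hφ).symm.trans (tderiv_congr ?_)
    filter_upwards [hfc.continuousAt.eventually (eventually_symm_extChartAt hfy)] with w hw
    exact hw
  rw [inChart_apply, inChart_apply, val_pullback, (extChartAt 𝓘(ℝ, F) z₀).left_inv hfy]
  ext v
  have := fun i => congrArg (fun T => T (v i)) key
  simp only [ContinuousLinearMap.comp_apply] at this
  simp only [ContinuousAlternatingMap.compContinuousLinearMap_apply, Function.comp_def, this]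

theorem inChart_pullback_eventuallyEq {k : ℕ} (η : Form F N k) {f : M → N} {x₀ x : M} {z₀ : N}
    (hx : x ∈ (extChartAt 𝓘(ℝ, E) x₀).source) (hf : ContMDiffAt 𝓘(ℝ, E) 𝓘(ℝ, F) ∞ f x)
    (hfx : f x ∈ (extChartAt 𝓘(ℝ, F) z₀).source) :
    (η.pullback f : Form E M k).inChart x₀ =ᶠ[𝓝 (extChartAt 𝓘(ℝ, E) x₀ x)] fun y =>
      (η.inChart z₀ (extChartAt 𝓘(ℝ, F) z₀ (f ((extChartAt 𝓘(ℝ, E) x₀).symm y)))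
        ).compContinuousLinearMap
        (fderiv ℝ (fun y => extChartAt 𝓘(ℝ, F) z₀ (f ((extChartAt 𝓘(ℝ, E) x₀).symm y))) y) := by
  have hc := continuousAt_extChartAt_symm'' (I := 𝓘(ℝ, E)) ((extChartAt 𝓘(ℝ, E) x₀).map_source hx)
  unfold ContinuousAt at hc
  rw [(extChartAt 𝓘(ℝ, E) x₀).left_inv hx] at hc
  filter_upwards [hc.eventually (eventually_mdifferentiableAt hf),
    hc.eventually (hf.continuousAt.eventually (extChartAt_source_mem_nhds' hfx)),
    extChartAt_target_mem_nhds' ((extChartAt 𝓘(ℝ, E) x₀).map_source hx)] with y h1 h2 h3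
  exact inChart_pullback η h3 h1 h2

theorem contDiffAt_written {f : M → N} {x₀ x : M} {z₀ : N}
    (hx : x ∈ (extChartAt 𝓘(ℝ, E) x₀).source) (hf : ContMDiffAt 𝓘(ℝ, E) 𝓘(ℝ, F) ∞ f x)
    (hfx : f x ∈ (extChartAt 𝓘(ℝ, F) z₀).source) :
    ContDiffAt ℝ ∞ (fun y => extChartAt 𝓘(ℝ, F) z₀ (f ((extChartAt 𝓘(ℝ, E) x₀).symm y)))
      (extChartAt 𝓘(ℝ, E) x₀ x) := by
  rw [← contMDiffAt_iff_contDiffAt]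
  have hl := (extChartAt 𝓘(ℝ, E) x₀).left_inv hx
  refine ContMDiffAt.comp (I' := 𝓘(ℝ, F)) _ (g := extChartAt 𝓘(ℝ, F) z₀)
    (f := fun y => f ((extChartAt 𝓘(ℝ, E) x₀).symm y)) ?_ ?_
  · simp only [hl]
    exact contMDiffAt_extChartAt_of_mem hfx
  · refine ContMDiffAt.comp (I' := 𝓘(ℝ, E)) _ (g := f) (f := (extChartAt 𝓘(ℝ, E) x₀).symm) ?_
      (contMDiffAt_extChartAt_symm_of_mem ((extChartAt 𝓘(ℝ, E) x₀).map_source hx))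
    simpa only [hl] using hf

theorem contDiffAt_inChart_pullback [FiniteDimensional ℝ E] {k : ℕ} {η : Form F N k} {f : M → N}
    {x₀ x : M} {z₀ : N}
    (hx : x ∈ (extChartAt 𝓘(ℝ, E) x₀).source) (hf : ContMDiffAt 𝓘(ℝ, E) 𝓘(ℝ, F) ∞ f x)
    (hfx : f x ∈ (extChartAt 𝓘(ℝ, F) z₀).source)
    (hη : ContDiffAt ℝ ∞ (η.inChart z₀) (extChartAt 𝓘(ℝ, F) z₀ (f x))) :
    ContDiffAt ℝ ∞ ((η.pullback f : Form E M k).inChart x₀) (extChartAt 𝓘(ℝ, E) x₀ x) := by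
  refine ContDiffAt.congr_of_eventuallyEq ?_ (inChart_pullback_eventuallyEq η hx hf hfx)
  have h := contDiffAt_written hx hf hfx
  refine contDiffAt_compContinuousLinearMap ?_ (h.fderiv_right (by simp))
  refine ContDiffAt.comp _ (g := η.inChart z₀) ?_ h
  simpa only [(extChartAt 𝓘(ℝ, E) x₀).left_inv hx] using hη

/-- A form is smooth as soon as its expression in the chart at each point is smooth there. -/
theorem isSmooth_of_contDiffAt [FiniteDimensional ℝ E] {k : ℕ} {η : Form E M k}
    (h : ∀ x, ContDiffAt ℝ ∞ (η.inChart x) (extChartAt 𝓘(ℝ, E) x x)) : η.IsSmooth := by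
  intro x₀ y hy
  have hx := (extChartAt 𝓘(ℝ, E) x₀).map_target hy
  -- Pulling back by the identity is a change of chart, from the chart at the point itself to the
  -- one at x₀.
  have := contDiffAt_inChart_pullback (η := η) hx contMDiffAt_id (mem_extChartAt_source _) (h _)
  rw [pullback_id, (extChartAt 𝓘(ℝ, E) x₀).right_inv hy] at this
  exact this.contDiffWithinAt

/-- The target chart z₀ is left free to serve twice: z₀ = f x gives naturality of d, and f = id
gives its independence of the chart. -/
theorem val_d_pullback_aux {k : ℕ} {η : Form F N k} (hη : η.IsSmooth) {f : M → N} {x : M} {z₀ : N}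
    (hf : ContMDiffAt 𝓘(ℝ, E) 𝓘(ℝ, F) ∞ f x)
    (hfx : f x ∈ (extChartAt 𝓘(ℝ, F) z₀).source) :
    (η.pullback f : Form E M k).d.val x =
      ((extDeriv (η.inChart z₀) (extChartAt 𝓘(ℝ, F) z₀ (f x))).compContinuousLinearMap
        (tderiv F F (extChartAt 𝓘(ℝ, F) z₀) (f x))).compContinuousLinearMap (tderiv E F f x) := by
  have hx := mem_extChartAt_source (I := 𝓘(ℝ, E)) x
  have hl := (extChartAt 𝓘(ℝ, E) x).left_inv hx
  have h := contDiffAt_written hx hf hfx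
  have hη' : ContDiffAt ℝ ∞ (η.inChart z₀) (extChartAt 𝓘(ℝ, F) z₀ (f x)) :=
    hη.contDiffAt ((extChartAt 𝓘(ℝ, F) z₀).map_source hfx)
  rw [val_d, (inChart_pullback_eventuallyEq η hx hf hfx).extDeriv_eq,
    extDeriv_pullback (r := ∞) (by simpa only [hl] using hη'.differentiableAt (by simp)) h
      minSmoothness_two_le_infty]
  have hc := mdifferentiableAt_of_contMDiffAt (contMDiffAt_extChartAt_of_mem hx)
  have hz := mdifferentiableAt_of_contMDiffAt (contMDiffAt_extChartAt_of_mem hfx)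
  have hf' := mdifferentiableAt_of_contMDiffAt hf
  have key : (fderiv ℝ (fun y => extChartAt 𝓘(ℝ, F) z₀ (f ((extChartAt 𝓘(ℝ, E) x).symm y)))
      (extChartAt 𝓘(ℝ, E) x x)).comp (tderiv E E (extChartAt 𝓘(ℝ, E) x) x) =
      (tderiv F F (extChartAt 𝓘(ℝ, F) z₀) (f x)).comp (tderiv E F f x) := by
    rw [← tderiv_eq_fderiv, ← tderiv_comp hz hf', ← tderiv_comp _ hc]
    · refine tderiv_congr ?_
      filter_upwards [eventually_symm_extChartAt hx] with w hw
      simp only [Function.comp_apply, hw]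
    · exact (contMDiffAt_iff_contDiffAt.mpr h).mdifferentiableAt (by simp)
  ext v
  have := fun i => congrArg (fun T => T (v i)) key
  simp only [ContinuousLinearMap.comp_apply] at this
  simp only [ContinuousAlternatingMap.compContinuousLinearMap_apply, Function.comp_def, this, hl]

/-- Naturality of the exterior derivative. -/
theorem val_d_pullback {k : ℕ} {η : Form F N k} (hη : η.IsSmooth) {f : M → N} {x : M}
    (hf : ContMDiffAt 𝓘(ℝ, E) 𝓘(ℝ, F) ∞ f x) :
    (η.pullback f : Form E M k).d.val x =
      (η.d.val (f x)).compContinuousLinearMap (tderiv E F f x) :=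
  val_d_pullback_aux hη hf (mem_extChartAt_source _)

theorem d_pullback {k : ℕ} {η : Form F N k} (hη : η.IsSmooth) {f : M → N}
    (hf : ContMDiff 𝓘(ℝ, E) 𝓘(ℝ, F) ∞ f) :
    (η.pullback f : Form E M k).d = η.d.pullback f :=
  ext_val fun x => val_d_pullback hη (hf x)

theorem val_d_eq {k : ℕ} {η : Form E M k} (hη : η.IsSmooth) {x₀ x : M}
    (hx : x ∈ (extChartAt 𝓘(ℝ, E) x₀).source) :
    η.d.val x = (extDeriv (η.inChart x₀) (extChartAt 𝓘(ℝ, E) x₀ x)).compContinuousLinearMap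
      (tderiv E E (extChartAt 𝓘(ℝ, E) x₀) x) := by
  have := val_d_pullback_aux (η := η) hη (f := id) (x := x) (z₀ := x₀) contMDiffAt_id hx
  rw [pullback_id, tderiv_id] at this
  exact this

/-- By chart independence this holds on the whole chart domain, not only at its center. That is what
allows a second derivative to be taken in `d_d`. -/
theorem inChart_d {k : ℕ} {η : Form E M k} (hη : η.IsSmooth) {x₀ : M} {y : E}
    (hy : y ∈ (extChartAt 𝓘(ℝ, E) x₀).target) :
    η.d.inChart x₀ y = extDeriv (η.inChart x₀) y := by
  rw [inChart_apply, val_d_eq hη ((extChartAt 𝓘(ℝ, E) x₀).map_target hy),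
    (extChartAt 𝓘(ℝ, E) x₀).right_inv hy]
  ext v
  have := fun i => congrArg (fun T => T (v i)) (tderiv_extChartAt_comp_symm (E := E) hy)
  simp only [ContinuousLinearMap.comp_apply, ContinuousLinearMap.id_apply] at this
  simp only [ContinuousAlternatingMap.compContinuousLinearMap_apply, Function.comp_def, this]

theorem d_d {k : ℕ} {η : Form E M k} (hη : η.IsSmooth) : η.d.d = 0 := by
  refine ext_val fun x => ?_
  have hy := mem_extChartAt_target (I := 𝓘(ℝ, E)) x
  have h : η.d.inChart x =ᶠ[𝓝 (extChartAt 𝓘(ℝ, E) x x)] extDeriv (η.inChart x) := by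
    filter_upwards [extChartAt_target_mem_nhds' hy] with y hy using inChart_d hη hy
  rw [val_d, h.extDeriv_eq, extDeriv_extDeriv_apply (hη.contDiffAt hy)
    minSmoothness_two_le_infty]
  rfl

end Form

end FormCalculus

/-! ### The vector field formula for d of a 1-form. -/

section VectorFieldFormula

variable {E : Type*} [NormedAddCommGroup E] [NormedSpace ℝ E]

theorem extDeriv_apply_pair {a : E → E [⋀^Fin 1]→L[ℝ] ℝ} {U W : E → E} {x : E}
    (ha : DifferentiableAt ℝ a x) (hU : DifferentiableAt ℝ U x) (hW : DifferentiableAt ℝ W x) :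
    extDeriv a x ![U x, W x] = fderiv ℝ (fun y => a y ![W y]) x (U x) -
      fderiv ℝ (fun y => a y ![U y]) x (W x) - a x ![VectorField.lieBracket ℝ U W x] := by
  have h := extDeriv_apply_vectorField (V := ![U, W]) ha
    (fun i => by fin_cases i <;> assumption)
  have h1 : (fun i => (![U, W] : Fin 2 → E → E) i x) = ![U x, W x] := by
    ext i; fin_cases i <;> rfl
  rw [h1] at h
  rw [h]
  have h2 : ∀ y, (Fin.removeNth 0 fun i => (![U, W] : Fin 2 → E → E) i y) = ![W y] := fun y => by
    ext i; fin_cases i; rfl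
  have h3 : ∀ y, (Fin.removeNth 1 fun i => (![U, W] : Fin 2 → E → E) i y) = ![U y] := fun y => by
    ext i; fin_cases i; rfl
  have h4 : ∀ (z : E) (w : Fin 0 → E), a x (Matrix.vecCons z w) = a x ![z] := fun z w => by
    rw [Subsingleton.elim w ![]]
  rw [Fin.sum_univ_two]
  simp only [h2, h3]
  simp [h4, sub_eq_add_neg]

end VectorFieldFormula

/-! ### Left and right invariant fields and the Lie bracket in the chart at the identity. -/

section LieGroupCharts

variable (E : Type*) [NormedAddCommGroup E] [NormedSpace ℝ E]
  (G : Type*) [TopologicalSpace G] [ChartedSpace E G] [Group G]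

/-- The multiplication of a Lie group in the chart at the identity. -/
def mulChart (p : E × E) : E :=
  extChartAt 𝓘(ℝ, E) (1 : G) ((extChartAt 𝓘(ℝ, E) (1 : G)).symm p.1 *
    (extChartAt 𝓘(ℝ, E) (1 : G)).symm p.2)

/-- The coordinates of the identity in the chart at the identity. -/
def oneChart : E := extChartAt 𝓘(ℝ, E) (1 : G) 1

/-- The left invariant vector field with value `u` at the identity, in the chart. -/
def leftField (u y : E) : E := fderiv ℝ (mulChart E G) (y, oneChart E G) (0, u)

/-- The right invariant vector field with value `v` at the identity, in the chart. -/
def rightField (v x : E) : E := fderiv ℝ (mulChart E G) (oneChart E G, x) (v, 0)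

variable {E G}

theorem oneChart_mem_target : oneChart E G ∈ (extChartAt 𝓘(ℝ, E) (1 : G)).target :=
  mem_extChartAt_target _

theorem symm_oneChart : (extChartAt 𝓘(ℝ, E) (1 : G)).symm (oneChart E G) = 1 :=
  extChartAt_to_inv _

variable [LieGroup 𝓘(ℝ, E) ∞ G]

theorem contDiffAt_mulChart : ContDiffAt ℝ ∞ (mulChart E G) (oneChart E G, oneChart E G) := by
  have hs : ContMDiffAt 𝓘(ℝ, E) 𝓘(ℝ, E) ∞ (extChartAt 𝓘(ℝ, E) (1 : G)).symm (oneChart E G) :=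
    contMDiffAt_extChartAt_symm_of_mem oneChart_mem_target
  have h1 : ContMDiffAt 𝓘(ℝ, E × E) 𝓘(ℝ, E) ∞ (fun p : E × E =>
      (extChartAt 𝓘(ℝ, E) (1 : G)).symm p.1) (oneChart E G, oneChart E G) :=
    ContMDiffAt.comp (oneChart E G, oneChart E G) hs contDiff_fst.contMDiff.contMDiffAt
  have h2 : ContMDiffAt 𝓘(ℝ, E × E) 𝓘(ℝ, E) ∞ (fun p : E × E =>
      (extChartAt 𝓘(ℝ, E) (1 : G)).symm p.2) (oneChart E G, oneChart E G) :=
    ContMDiffAt.comp (oneChart E G, oneChart E G) hs contDiff_snd.contMDiff.contMDiffAt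
  rw [← contMDiffAt_iff_contDiffAt]
  refine ContMDiffAt.comp _ ?_ (h1.mul h2)
  simp only [symm_oneChart, mul_one]
  exact contMDiffAt_extChartAt

theorem tderiv_symm_oneChart :
    tderiv E E (extChartAt 𝓘(ℝ, E) (1 : G)).symm (oneChart E G) = ContinuousLinearMap.id ℝ E := by
  have := tderiv_extChartAt_comp_symm (E := E) (x₀ := (1 : G)) oneChart_mem_target
  rw [symm_oneChart, tderiv_extChartAt_self] at this
  simpa using this

theorem continuousAt_symm_oneChart :
    Tendsto (extChartAt 𝓘(ℝ, E) (1 : G)).symm (𝓝 (oneChart E G)) (𝓝 1) := by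
  have := continuousAt_extChartAt_symm (I := 𝓘(ℝ, E)) (1 : G)
  rwa [ContinuousAt, extChartAt_to_inv] at this

theorem contMDiff_mulLeft (g : G) : ContMDiff 𝓘(ℝ, E) 𝓘(ℝ, E) ∞ (fun x => g * x) :=
  contMDiff_mul_left

theorem contMDiff_mulRight (g : G) : ContMDiff 𝓘(ℝ, E) 𝓘(ℝ, E) ∞ (fun x => x * g) :=
  contMDiff_mul_right

theorem mdifferentiable_mulLeft (g : G) : MDifferentiable 𝓘(ℝ, E) 𝓘(ℝ, E) (fun x => g * x) :=
  (contMDiff_mulLeft g).mdifferentiable (by simp)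

theorem mdifferentiable_mulRight (g : G) : MDifferentiable 𝓘(ℝ, E) 𝓘(ℝ, E) (fun x => x * g) :=
  (contMDiff_mulRight g).mdifferentiable (by simp)

theorem eventually_differentiableAt_mulChart :
    ∀ᶠ p in 𝓝 (oneChart E G, oneChart E G), DifferentiableAt ℝ (mulChart E G) p := by
  have h : ContDiffAt ℝ 1 (mulChart E G) (oneChart E G, oneChart E G) :=
    contDiffAt_mulChart.of_le (by simp)
  filter_upwards [h.eventually (by simp)] with p hp using hp.differentiableAt (by simp)

theorem tendsto_mk_oneChart :
    Tendsto (fun y => (y, oneChart E G)) (𝓝 (oneChart E G)) (𝓝 (oneChart E G, oneChart E G)) :=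
  (Continuous.prodMk_left _).continuousAt

theorem tendsto_oneChart_mk :
    Tendsto (fun y => (oneChart E G, y)) (𝓝 (oneChart E G)) (𝓝 (oneChart E G, oneChart E G)) :=
  (Continuous.prodMk_right _).continuousAt

/-- With c the chart at 1, differentiate c⁻¹(m(y, x)) = c⁻¹(y) c⁻¹(x) in x at the identity. This
identifies `leftField` with the coordinate expression of the invariant field. -/
theorem tderiv_symm_leftField (u : E) : ∀ᶠ y in 𝓝 (oneChart E G),
    tderiv E E (extChartAt 𝓘(ℝ, E) (1 : G)).symm y (leftField E G u y) =
      tderiv E E (fun x => (extChartAt 𝓘(ℝ, E) (1 : G)).symm y * x) 1 u := by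
  filter_upwards [tendsto_mk_oneChart.eventually eventually_differentiableAt_mulChart,
    extChartAt_target_mem_nhds' (oneChart_mem_target (E := E) (G := G))] with y hy hyt
  set g := (extChartAt 𝓘(ℝ, E) (1 : G)).symm y with hg
  have hm : mulChart E G (y, oneChart E G) = y := by
    simp only [mulChart, symm_oneChart, mul_one]
    exact (extChartAt 𝓘(ℝ, E) (1 : G)).right_inv hyt
  have hd : HasFDerivAt (fun x => mulChart E G (y, x))
      ((fderiv ℝ (mulChart E G) (y, oneChart E G)).comp (ContinuousLinearMap.inr ℝ E E))
      (oneChart E G) := HasFDerivAt.comp (g := mulChart E G) (f := fun x => (y, x)) (oneChart E G)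
        hy.hasFDerivAt (hasFDerivAt_prodMk_right _ _)
  have h1 : leftField E G u y = tderiv E E (fun x => mulChart E G (y, x)) (oneChart E G) u := by
    rw [tderiv_eq_fderiv, hd.fderiv]; rfl
  have hs1 := mdifferentiableAt_of_contMDiffAt (contMDiffAt_extChartAt_symm_of_mem hyt)
  have hs2 := mdifferentiableAt_of_contMDiffAt
    (contMDiffAt_extChartAt_symm_of_mem (oneChart_mem_target (E := E) (G := G)))
  have hc : tderiv E E ((extChartAt 𝓘(ℝ, E) (1 : G)).symm ∘ fun x => mulChart E G (y, x))
      (oneChart E G) = tderiv E E ((fun x => g * x) ∘ (extChartAt 𝓘(ℝ, E) (1 : G)).symm)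
      (oneChart E G) := by
    refine tderiv_congr ?_
    have ht : Tendsto (fun x => g * (extChartAt 𝓘(ℝ, E) (1 : G)).symm x) (𝓝 (oneChart E G))
        (𝓝 g) := by
      have := (contMDiff_mulLeft (E := E) g).continuous.continuousAt.tendsto.comp
        (continuousAt_symm_oneChart (E := E) (G := G))
      simpa [Function.comp_def] using this
    filter_upwards [ht.eventually (eventually_symm_extChartAt (E := E)
      ((extChartAt 𝓘(ℝ, E) (1 : G)).map_target hyt))] with x hx
    exact hx
  rw [tderiv_comp (F := E) _ hd.differentiableAt.mdifferentiableAt,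
    tderiv_comp (F := E) (mdifferentiable_mulLeft g _) hs2, symm_oneChart, tderiv_symm_oneChart,
    hm] at hc
  · rw [h1]
    exact congrArg (fun T => T u) hc
  · rw [hm]; exact hs1

theorem tderiv_symm_rightField (u : E) : ∀ᶠ y in 𝓝 (oneChart E G),
    tderiv E E (extChartAt 𝓘(ℝ, E) (1 : G)).symm y (rightField E G u y) =
      tderiv E E (fun x => x * (extChartAt 𝓘(ℝ, E) (1 : G)).symm y) 1 u := by
  filter_upwards [tendsto_oneChart_mk.eventually eventually_differentiableAt_mulChart,
    extChartAt_target_mem_nhds' (oneChart_mem_target (E := E) (G := G))] with y hy hyt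
  set g := (extChartAt 𝓘(ℝ, E) (1 : G)).symm y with hg
  have hm : mulChart E G (oneChart E G, y) = y := by
    simp only [mulChart, symm_oneChart, one_mul]
    exact (extChartAt 𝓘(ℝ, E) (1 : G)).right_inv hyt
  have hd : HasFDerivAt (fun x => mulChart E G (x, y))
      ((fderiv ℝ (mulChart E G) (oneChart E G, y)).comp (ContinuousLinearMap.inl ℝ E E))
      (oneChart E G) := HasFDerivAt.comp (g := mulChart E G) (f := fun x => (x, y)) (oneChart E G)
        hy.hasFDerivAt (hasFDerivAt_prodMk_left _ _)
  have h1 : rightField E G u y = tderiv E E (fun x => mulChart E G (x, y)) (oneChart E G) u := by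
    rw [tderiv_eq_fderiv, hd.fderiv]; rfl
  have hs1 := mdifferentiableAt_of_contMDiffAt (contMDiffAt_extChartAt_symm_of_mem hyt)
  have hs2 := mdifferentiableAt_of_contMDiffAt
    (contMDiffAt_extChartAt_symm_of_mem (oneChart_mem_target (E := E) (G := G)))
  have hc : tderiv E E ((extChartAt 𝓘(ℝ, E) (1 : G)).symm ∘ fun x => mulChart E G (x, y))
      (oneChart E G) = tderiv E E ((fun x => x * g) ∘ (extChartAt 𝓘(ℝ, E) (1 : G)).symm)
      (oneChart E G) := by
    refine tderiv_congr ?_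
    have ht : Tendsto (fun x => (extChartAt 𝓘(ℝ, E) (1 : G)).symm x * g) (𝓝 (oneChart E G))
        (𝓝 g) := by
      have := (contMDiff_mulRight (E := E) g).continuous.continuousAt.tendsto.comp
        (continuousAt_symm_oneChart (E := E) (G := G))
      simpa [Function.comp_def] using this
    filter_upwards [ht.eventually (eventually_symm_extChartAt (E := E)
      ((extChartAt 𝓘(ℝ, E) (1 : G)).map_target hyt))] with x hx
    exact hx
  rw [tderiv_comp (F := E) _ hd.differentiableAt.mdifferentiableAt,
    tderiv_comp (F := E) (mdifferentiable_mulRight g _) hs2, symm_oneChart, tderiv_symm_oneChart,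
    hm] at hc
  · rw [h1]
    exact congrArg (fun T => T u) hc
  · rw [hm]; exact hs1

theorem hasFDerivAt_leftField (u : E) : HasFDerivAt (leftField E G u)
    (((fderiv ℝ (fderiv ℝ (mulChart E G)) (oneChart E G, oneChart E G)).comp
      (ContinuousLinearMap.inl ℝ E E)).flip (0, u)) (oneChart E G) := by
  have h : DifferentiableAt ℝ (fderiv ℝ (mulChart E G)) (oneChart E G, oneChart E G) :=
    ((contDiffAt_mulChart (E := E) (G := G)).fderiv_right (m := ∞) (by simp)).differentiableAt
      (by simp)
  have h2 := HasFDerivAt.comp (f := fun x => (x, oneChart E G)) (oneChart E G) h.hasFDerivAt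
    (hasFDerivAt_prodMk_left (oneChart E G) (oneChart E G))
  exact (ContinuousLinearMap.apply ℝ E ((0, u) : E × E)).hasFDerivAt.comp (oneChart E G) h2

theorem hasFDerivAt_rightField (v : E) : HasFDerivAt (rightField E G v)
    (((fderiv ℝ (fderiv ℝ (mulChart E G)) (oneChart E G, oneChart E G)).comp
      (ContinuousLinearMap.inr ℝ E E)).flip (v, 0)) (oneChart E G) := by
  have h : DifferentiableAt ℝ (fderiv ℝ (mulChart E G)) (oneChart E G, oneChart E G) :=
    ((contDiffAt_mulChart (E := E) (G := G)).fderiv_right (m := ∞) (by simp)).differentiableAt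
      (by simp)
  have h2 := HasFDerivAt.comp (f := fun x => (oneChart E G, x)) (oneChart E G) h.hasFDerivAt
    (hasFDerivAt_prodMk_right (oneChart E G) (oneChart E G))
  exact (ContinuousLinearMap.apply ℝ E ((v, 0) : E × E)).hasFDerivAt.comp (oneChart E G) h2

theorem tderiv_one_mul : tderiv E E (fun x : G => 1 * x) 1 = ContinuousLinearMap.id ℝ E := by
  simp only [one_mul]
  exact tderiv_id _

theorem tderiv_mul_one : tderiv E E (fun x : G => x * 1) 1 = ContinuousLinearMap.id ℝ E := by
  simp only [mul_one]
  exact tderiv_id _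

theorem leftField_one (u : E) : leftField E G u (oneChart E G) = u := by
  have := (tderiv_symm_leftField (G := G) u).self_of_nhds
  rw [symm_oneChart, tderiv_symm_oneChart, tderiv_one_mul] at this
  exact this

theorem rightField_one (v : E) : rightField E G v (oneChart E G) = v := by
  have := (tderiv_symm_rightField (G := G) v).self_of_nhds
  rw [symm_oneChart, tderiv_symm_oneChart, tderiv_mul_one] at this
  exact this

/-- Left and right invariant vector fields commute. -/
theorem lieBracket_leftField_rightField (u v : E) :
    VectorField.lieBracket ℝ (leftField E G u) (rightField E G v) (oneChart E G) = 0 := by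
  -- The derivatives of the two fields are the two mixed second derivatives of the multiplication,
  -- which agree by symmetry.
  have hsymm : IsSymmSndFDerivAt ℝ (mulChart E G) (oneChart E G, oneChart E G) :=
    (contDiffAt_mulChart (E := E) (G := G)).isSymmSndFDerivAt minSmoothness_two_le_infty
  rw [VectorField.lieBracket, (hasFDerivAt_leftField u).fderiv, (hasFDerivAt_rightField v).fderiv,
    leftField_one, rightField_one]
  have := hsymm.eq (0, u) (v, 0)
  simpa [sub_eq_zero] using this

variable (G) in
/-- The bracket of the Lie algebra, on the model space. -/
def lieAlgebraBracket (u v : E) : E :=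
  (fun u v : GroupLieAlgebra 𝓘(ℝ, E) G => ⁅u, v⁆) u v

theorem lieAlgebraBracket_eq (u v : E) :
    lieAlgebraBracket G u v = VectorField.lieBracket ℝ (leftField E G u) (leftField E G v) (oneChart E G) := by
  have key : ∀ u : E, (fun y => (tderiv E E (extChartAt 𝓘(ℝ, E) (1 : G)).symm y).inverse
      (tderiv E E (fun x => (extChartAt 𝓘(ℝ, E) (1 : G)).symm y * x) 1 u)) =ᶠ[𝓝 (oneChart E G)]
      leftField E G u := fun u => by
    filter_upwards [tderiv_symm_leftField (G := G) u,
      extChartAt_target_mem_nhds' (oneChart_mem_target (E := E) (G := G))] with y hy hyt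
    have h1 := tderiv_extChartAt_comp_symm (E := E) hyt
    have hs1 := mdifferentiableAt_of_contMDiffAt (contMDiffAt_extChartAt_symm_of_mem hyt)
    have hyr : extChartAt 𝓘(ℝ, E) (1 : G) ((extChartAt 𝓘(ℝ, E) (1 : G)).symm y) = y :=
      (extChartAt 𝓘(ℝ, E) (1 : G)).right_inv hyt
    have hym := (extChartAt 𝓘(ℝ, E) (1 : G)).map_target hyt
    have h2 : (tderiv E E (extChartAt 𝓘(ℝ, E) (1 : G)).symm y).comp
        (tderiv E E (extChartAt 𝓘(ℝ, E) (1 : G)) ((extChartAt 𝓘(ℝ, E) (1 : G)).symm y)) =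
        ContinuousLinearMap.id ℝ E := by
      have h3 := tderiv_comp (F := E) (F' := E) (g := (extChartAt 𝓘(ℝ, E) (1 : G)).symm)
        (f := extChartAt 𝓘(ℝ, E) (1 : G)) (x := (extChartAt 𝓘(ℝ, E) (1 : G)).symm y)
        (by rw [hyr]; exact hs1)
        (mdifferentiableAt_of_contMDiffAt (contMDiffAt_extChartAt_of_mem hym))
      rw [hyr] at h3
      rw [← h3, ← tderiv_id (E := E) (M := G) ((extChartAt 𝓘(ℝ, E) (1 : G)).symm y)]
      exact tderiv_congr (eventually_symm_extChartAt hym)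
    rw [ContinuousLinearMap.inverse_eq h2 h1, ← hy]
    exact congrArg (fun T => T (leftField E G u y)) h1
  have hself : tderiv E E (extChartAt 𝓘(ℝ, E) (1 : G)) 1 = ContinuousLinearMap.id ℝ E :=
    tderiv_extChartAt_self (E := E) (1 : G)
  let D : E → E →L[ℝ] E := fun y =>
    mfderivWithin 𝓘(ℝ, E) 𝓘(ℝ, E) (extChartAt 𝓘(ℝ, E) (1 : G)).symm (Set.range 𝓘(ℝ, E)) y
  have hr : Set.range 𝓘(ℝ, E) = Set.univ := by simp
  have hD : ∀ y, D y = tderiv E E (extChartAt 𝓘(ℝ, E) (1 : G)).symm y := fun y => by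
    simp only [D, hr, mfderivWithin_univ]; rfl
  -- The bracket of invariant fields unfolds to the bracket of their pullbacks along the inverse
  -- chart. By `key` these pullbacks agree near the identity with the fields in coordinates.
  have h : lieAlgebraBracket G u v = (tderiv E E (extChartAt 𝓘(ℝ, E) (1 : G)) 1).inverse
      (VectorField.lieBracketWithin ℝ
        (fun y => (D y).inverse
          (tderiv E E (fun x => (extChartAt 𝓘(ℝ, E) (1 : G)).symm y * x) 1 u))
        (fun y => (D y).inverse
          (tderiv E E (fun x => (extChartAt 𝓘(ℝ, E) (1 : G)).symm y * x) 1 v))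
        ((extChartAt 𝓘(ℝ, E) (1 : G)).symm ⁻¹' Set.univ ∩ Set.range 𝓘(ℝ, E)) (oneChart E G)) := rfl
  rw [h, hself, hr, Set.preimage_univ, Set.inter_univ, VectorField.lieBracketWithin_univ]
  simp only [hD]
  rw [ContinuousLinearMap.inverse_id]
  exact Filter.EventuallyEq.lieBracket_vectorField_eq (key u) (key v)

end LieGroupCharts

/-! ### Left invariant forms. -/

section LeftInvariant

variable {E : Type*} [NormedAddCommGroup E] [NormedSpace ℝ E]
  {G : Type*} [TopologicalSpace G] [ChartedSpace E G] [Group G]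

namespace Form

theorem IsLeftInvariant.val_mul {k : ℕ} {η : Form E G k} (h : η.IsLeftInvariant) (g x : G) :
    (η.val (g * x)).compContinuousLinearMap (tderiv E E (fun x => g * x) x) = η.val x :=
  congrArg (fun θ : Form E G k => θ.val x) (h g)

theorem IsLeftInvariant.val_eq {k : ℕ} {η : Form E G k} (h : η.IsLeftInvariant) (g : G) :
    η.val g = (η.val 1).compContinuousLinearMap (tderiv E E (fun x => g⁻¹ * x) g) := by
  rw [← h.val_mul g⁻¹ g, inv_mul_cancel]

theorem IsLeftInvariant.ext {k : ℕ} {η θ : Form E G k} (hη : η.IsLeftInvariant)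
    (hθ : θ.IsLeftInvariant) (h : η.val 1 = θ.val 1) : η = θ :=
  ext_val fun g => by rw [hη.val_eq, hθ.val_eq, h]

theorem IsLeftInvariant.neg {k : ℕ} {η : Form E G k} (h : η.IsLeftInvariant) :
    (-η).IsLeftInvariant := fun g => by rw [pullback_neg, h g]

variable [LieGroup 𝓘(ℝ, E) ∞ G]

theorem IsLeftInvariant.d {k : ℕ} {η : Form E G k} (h : η.IsLeftInvariant) (hη : η.IsSmooth) :
    η.d.IsLeftInvariant := fun g => by
  rw [← d_pullback hη (contMDiff_mulLeft g)]
  exact congrArg Form.d (h g)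

/-- The left invariant form with a given value at the identity. -/
def leftInvariant (G : Type*) [TopologicalSpace G] [ChartedSpace E G] [Group G] {k : ℕ}
    (β : E [⋀^Fin k]→L[ℝ] ℝ) : Form E G k :=
  fun g => β.compContinuousLinearMap (tderiv E E (fun x : G => g⁻¹ * x) g)

theorem val_leftInvariant {k : ℕ} (β : E [⋀^Fin k]→L[ℝ] ℝ) (g : G) :
    (leftInvariant G β).val g = β.compContinuousLinearMap (tderiv E E (fun x : G => g⁻¹ * x) g) :=
  rfl

theorem val_one_leftInvariant {k : ℕ} (β : E [⋀^Fin k]→L[ℝ] ℝ) :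
    (leftInvariant G β).val 1 = β := by
  rw [val_leftInvariant, inv_one, tderiv_one_mul]; rfl

theorem isLeftInvariant_leftInvariant {k : ℕ} (β : E [⋀^Fin k]→L[ℝ] ℝ) :
    (leftInvariant G β).IsLeftInvariant := fun g => ext_val fun x => by
  rw [val_pullback, val_leftInvariant, val_leftInvariant]
  have := tderiv_comp (F := E) (F' := E) (x := x) (mdifferentiable_mulLeft (E := E) (g * x)⁻¹ (g * x))
    (mdifferentiable_mulLeft g x)
  have h2 : (fun y => (g * x)⁻¹ * y) ∘ (fun x => g * x) = fun y => x⁻¹ * y := by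
    funext y; simp
  rw [h2] at this
  rw [this]
  rfl

/-- In coordinates the form at y is β composed with the z-derivative, at z = y, of the map (y, z) ↦
y⁻¹ z. A partial derivative of a jointly smooth map is smooth along the diagonal. -/
theorem isSmooth_leftInvariant [FiniteDimensional ℝ E] {k : ℕ} (β : E [⋀^Fin k]→L[ℝ] ℝ) :
    (leftInvariant G β).IsSmooth := by
  refine isSmooth_of_contDiffAt fun x₀ => ?_
  let c := extChartAt 𝓘(ℝ, E) x₀
  let n : E → E → E := fun y z => extChartAt 𝓘(ℝ, E) (1 : G) ((c.symm y)⁻¹ * c.symm z)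
  have hn : ContDiffAt ℝ ∞ (Function.uncurry n) (c x₀, c x₀) := by
    have hs : ContMDiffAt 𝓘(ℝ, E) 𝓘(ℝ, E) ∞ c.symm (c x₀) :=
      contMDiffAt_extChartAt_symm_of_mem (mem_extChartAt_target x₀)
    have h1 : ContMDiffAt 𝓘(ℝ, E × E) 𝓘(ℝ, E) ∞ (fun p : E × E => c.symm p.1) (c x₀, c x₀) :=
      ContMDiffAt.comp (c x₀, c x₀) hs contDiff_fst.contMDiff.contMDiffAt
    have h2 : ContMDiffAt 𝓘(ℝ, E × E) 𝓘(ℝ, E) ∞ (fun p : E × E => c.symm p.2) (c x₀, c x₀) :=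
      ContMDiffAt.comp (c x₀, c x₀) hs contDiff_snd.contMDiff.contMDiffAt
    rw [← contMDiffAt_iff_contDiffAt]
    refine ContMDiffAt.comp (g := extChartAt 𝓘(ℝ, E) (1 : G)) _ ?_ (h1.inv.mul h2)
    simp only [inv_mul_cancel]
    exact contMDiffAt_extChartAt
  have hd : ContDiffAt ℝ ∞ (fun y => fderiv ℝ (n y) y) (c x₀) :=
    ContDiffAt.fderiv hn contDiffAt_id (by simp)
  refine (contDiffAt_compContinuousLinearMap (contDiffAt_const (c := β)) hd).congr_of_eventuallyEq ?_
  filter_upwards [extChartAt_target_mem_nhds' (mem_extChartAt_target (I := 𝓘(ℝ, E)) x₀)] with y hy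
  rw [inChart_apply, val_leftInvariant]
  have hs1 := mdifferentiableAt_of_contMDiffAt (contMDiffAt_extChartAt_symm_of_mem hy)
  have hl := mdifferentiable_mulLeft (E := E) (c.symm y)⁻¹ (c.symm y)
  have h1 : MDifferentiableAt 𝓘(ℝ, E) 𝓘(ℝ, E) (extChartAt 𝓘(ℝ, E) (1 : G))
      ((c.symm y)⁻¹ * c.symm y) := by
    rw [inv_mul_cancel]
    exact mdifferentiableAt_of_contMDiffAt contMDiffAt_extChartAt
  have h2 := tderiv_comp (F := E) (F' := E) (x := y) (hl : MDifferentiableAt 𝓘(ℝ, E) 𝓘(ℝ, E)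
    (fun x => (c.symm y)⁻¹ * x) (c.symm y)) hs1
  have h3 := tderiv_comp (F := E) (F' := E) (x := y) (f := (fun x => (c.symm y)⁻¹ * x) ∘ c.symm) h1
    (hl.comp y hs1)
  have hself : tderiv E E (extChartAt 𝓘(ℝ, E) (1 : G)) ((c.symm y)⁻¹ * c.symm y) =
      ContinuousLinearMap.id ℝ E := by
    rw [inv_mul_cancel]; exact tderiv_extChartAt_self (E := E) (1 : G)
  have h4 : fderiv ℝ (n y) y = (tderiv E E (fun x => (c.symm y)⁻¹ * x) (c.symm y)).comp
      (tderiv E E c.symm y) := by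
    rw [← tderiv_eq_fderiv, ← h2]
    refine h3.trans ?_
    simp only [Function.comp_apply]
    rw [hself]
    rfl
  rw [h4]
  rfl

theorem IsLeftInvariant.inChart_leftField {α : Form E G 1} (h : α.IsLeftInvariant) (u : E) :
    ∀ᶠ y in 𝓝 (oneChart E G), α.inChart 1 y ![leftField E G u y] = α.val 1 ![u] := by
  filter_upwards [tderiv_symm_leftField (G := G) u] with y hy
  rw [inChart_apply, ← h.val_mul ((extChartAt 𝓘(ℝ, E) (1 : G)).symm y) 1, mul_one]
  simp only [ContinuousAlternatingMap.compContinuousLinearMap_apply]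
  congr 1
  ext i
  fin_cases i
  exact hy

theorem val_d_one {α : Form E G 1} :
    α.d.val 1 = extDeriv (α.inChart 1) (oneChart E G) := by
  rw [val_d, tderiv_extChartAt_self]; rfl

theorem IsLeftInvariant.fderiv_leftField {α : Form E G 1} (h : α.IsLeftInvariant) (u : E) :
    fderiv ℝ (fun y => α.inChart 1 y ![leftField E G u y]) (oneChart E G) = 0 := by
  have h1 : (fun y => α.inChart 1 y ![leftField E G u y]) =ᶠ[𝓝 (oneChart E G)]
    fun _ => α.val 1 ![u] := h.inChart_leftField u
  rw [h1.fderiv_eq, fderiv_fun_const]; rfl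

theorem IsSmooth.differentiableAt_one {k : ℕ} {α : Form E G k} (hα : α.IsSmooth) :
    DifferentiableAt ℝ (α.inChart (1 : G)) (oneChart E G) :=
  (hα.contDiffAt (oneChart_mem_target (E := E) (G := G))).differentiableAt (by simp)

/-- The exterior derivative of a left invariant `1`-form in terms of the Lie bracket. -/
theorem IsLeftInvariant.val_d_one_apply {α : Form E G 1} (h : α.IsLeftInvariant)
    (hα : α.IsSmooth) (u v : E) :
    α.d.val 1 ![u, v] = -(α.val 1 ![lieAlgebraBracket G u v]) := by
  have h1 := extDeriv_apply_pair hα.differentiableAt_one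
    (hasFDerivAt_leftField (G := G) (u : E)).differentiableAt
    (hasFDerivAt_leftField (G := G) (v : E)).differentiableAt
  -- α is constant on left invariant fields, so only the bracket term survives.
  rw [h.fderiv_leftField, h.fderiv_leftField, leftField_one, leftField_one,
    ← lieAlgebraBracket_eq, ← val_d_one] at h1
  rw [h1, inChart_apply, symm_oneChart, tderiv_symm_oneChart]
  simp only [zero_apply, sub_self, zero_sub]
  rfl

/-- The coadjoint orbit map `g ↦ (R_g^* α)_1`. -/
def coadjointOrbitMap (α : Form E G 1) (g : G) : E [⋀^Fin 1]→L[ℝ] ℝ :=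
  (α.pullback (fun x => x * g) : Form E G 1).val 1

theorem coadjointOrbitMap_symm_apply (α : Form E G 1) (v : E) : ∀ᶠ y in 𝓝 (oneChart E G),
    α.coadjointOrbitMap ((extChartAt 𝓘(ℝ, E) (1 : G)).symm y) ![v] =
      α.inChart 1 y ![rightField E G v y] := by
  filter_upwards [tderiv_symm_rightField (G := G) v] with y hy
  rw [inChart_apply, coadjointOrbitMap, val_pullback, one_mul]
  simp only [ContinuousAlternatingMap.compContinuousLinearMap_apply]
  congr 1
  ext i
  fin_cases i
  exact hy.symm

end Form

end LeftInvariant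

/-! ### The coadjoint orbit map: equivariance, smoothness and derivative. -/

section CoadjointOrbitMap

variable {E : Type*} [NormedAddCommGroup E] [NormedSpace ℝ E]
  {G : Type*} [TopologicalSpace G] [ChartedSpace E G] [Group G] [LieGroup 𝓘(ℝ, E) ∞ G]

namespace Form

/-- Since y g x = g ((g⁻¹ y g) x), right translation by gx is a conjugation, then right translation
by x, then left translation by g, which α ignores. This equivariance transports smoothness at 1 to
all of G. -/
theorem IsLeftInvariant.coadjointOrbitMap_mul {α : Form E G 1} (h : α.IsLeftInvariant) (g x : G) :
    α.coadjointOrbitMap (g * x) = (α.coadjointOrbitMap x).compContinuousLinearMap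
      (tderiv E E (fun y => g⁻¹ * (y * g)) 1) := by
  have hc : ContMDiff 𝓘(ℝ, E) 𝓘(ℝ, E) ∞ (fun y => g⁻¹ * (y * g)) :=
    (contMDiff_mulLeft g⁻¹).comp (contMDiff_mulRight g)
  have h1 : (α.pullback (fun y => y * (g * x)) : Form E G 1) =
      (α.pullback (fun y => y * x) : Form E G 1).pullback (fun y => g⁻¹ * (y * g)) := by
    conv_rhs => rw [← h g]
    rw [pullback_pullback _ (mdifferentiable_mulLeft g) (mdifferentiable_mulRight x),
      pullback_pullback _ (((contMDiff_mulLeft g).comp (contMDiff_mulRight x)).mdifferentiable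
        (by simp)) (hc.mdifferentiable (by simp))]
    congr 1
    funext y
    simp [mul_assoc]
  rw [coadjointOrbitMap, coadjointOrbitMap, h1, val_pullback]
  simp

/-- For central z one has y g z = z (y g), and α does not see left translation by z. -/
theorem IsLeftInvariant.coadjointOrbitMap_mul_of_mem_center {α : Form E G 1}
    (h : α.IsLeftInvariant) (g : G) {z : G} (hz : z ∈ Subgroup.center G) :
    α.coadjointOrbitMap (g * z) = α.coadjointOrbitMap g := by
  have h1 : (α.pullback (fun y => y * (g * z)) : Form E G 1) =
      (α.pullback (fun y => y * g) : Form E G 1) := by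
    conv_rhs => rw [← h z]
    rw [pullback_pullback _ (mdifferentiable_mulLeft z) (mdifferentiable_mulRight g)]
    congr 1
    funext y
    rw [Function.comp_apply, ← mul_assoc]
    exact Subgroup.mem_center_iff.mp hz _
  rw [coadjointOrbitMap, h1, coadjointOrbitMap]

variable [FiniteDimensional ℝ E]

theorem coadjointOrbitMap_symm_eventuallyEq (α : Form E G 1) :
    (fun y => α.coadjointOrbitMap ((extChartAt 𝓘(ℝ, E) (1 : G)).symm y))
      =ᶠ[𝓝 (oneChart E G)] fun y => (α.inChart 1 y).compContinuousLinearMap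
        ((fderiv ℝ (mulChart E G) (oneChart E G, y)).comp (ContinuousLinearMap.inl ℝ E E)) := by
  let b := Module.finBasis ℝ E
  -- Each vector comes with its own neighborhood. A finite basis leaves a common one.
  have h := eventually_all.mpr fun i => coadjointOrbitMap_symm_apply α (b i)
  filter_upwards [h] with y hy
  refine ContinuousAlternatingMap.toAlternatingMap_injective
    (Module.Basis.ext_alternating b fun v _ => ?_)
  have hv : (fun i => b (v i)) = ![b (v 0)] := by ext i; fin_cases i; rfl
  rw [hv]
  refine (hy (v 0)).trans ?_
  simp only [ContinuousAlternatingMap.coe_toAlternatingMap,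
    ContinuousAlternatingMap.compContinuousLinearMap_apply]
  congr 1
  ext i; fin_cases i; rfl

theorem IsSmooth.contDiffAt_coadjointOrbitMap_symm {α : Form E G 1} (hα : α.IsSmooth) :
    ContDiffAt ℝ ∞ (fun y => α.coadjointOrbitMap ((extChartAt 𝓘(ℝ, E) (1 : G)).symm y))
      (oneChart E G) := by
  refine ContDiffAt.congr_of_eventuallyEq ?_ (coadjointOrbitMap_symm_eventuallyEq α)
  refine contDiffAt_compContinuousLinearMap (hα.contDiffAt oneChart_mem_target) ?_
  have h1 : ContDiffAt ℝ ∞ (fderiv ℝ (mulChart E G)) (oneChart E G, oneChart E G) :=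
    contDiffAt_mulChart.fderiv_right (by simp)
  have h2 : ContDiffAt ℝ ∞ (fun y => fderiv ℝ (mulChart E G) (oneChart E G, y)) (oneChart E G) :=
    ContDiffAt.comp (g := fderiv ℝ (mulChart E G)) (oneChart E G) h1
      (contDiffAt_const.prodMk contDiffAt_id)
  exact h2.clm_comp contDiffAt_const

theorem IsSmooth.contMDiffAt_coadjointOrbitMap_one {α : Form E G 1} (hα : α.IsSmooth) :
    ContMDiffAt 𝓘(ℝ, E) 𝓘(ℝ, E [⋀^Fin 1]→L[ℝ] ℝ) ∞ α.coadjointOrbitMap (1 : G) := by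
  have h := (contMDiffAt_iff_contDiffAt.mpr hα.contDiffAt_coadjointOrbitMap_symm).comp (1 : G)
    (contMDiffAt_extChartAt (I := 𝓘(ℝ, E)) (x := (1 : G)))
  refine h.congr_of_eventuallyEq ?_
  filter_upwards [eventually_symm_extChartAt (E := E) (mem_extChartAt_source (1 : G))] with x hx
  simp only [Function.comp_apply, hx]

theorem IsLeftInvariant.contMDiff_coadjointOrbitMap {α : Form E G 1} (h : α.IsLeftInvariant)
    (hα : α.IsSmooth) :
    ContMDiff 𝓘(ℝ, E) 𝓘(ℝ, E [⋀^Fin 1]→L[ℝ] ℝ) ∞ (α.coadjointOrbitMap : G → _) := by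
  intro g
  let A : (E [⋀^Fin 1]→L[ℝ] ℝ) →L[ℝ] (E [⋀^Fin 1]→L[ℝ] ℝ) :=
    ContinuousAlternatingMap.compContinuousLinearMapCLM (tderiv E E (fun y : G => g⁻¹ * (y * g)) 1)
  have h1 : α.coadjointOrbitMap = A ∘ α.coadjointOrbitMap ∘ fun x => g⁻¹ * x := by
    funext x
    have := h.coadjointOrbitMap_mul g (g⁻¹ * x)
    rw [mul_inv_cancel_left] at this
    exact this
  rw [h1]
  refine A.contDiff.contMDiff.contMDiffAt.comp g (ContMDiffAt.comp g ?_
    (contMDiff_mulLeft g⁻¹).contMDiffAt)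
  rw [inv_mul_cancel]
  exact hα.contMDiffAt_coadjointOrbitMap_one

/-- In the formula for dα, take the left invariant field U through u and the right invariant field W
through v. Then α(U) is constant and [U, W] = 0 at the identity, so only U(α(W)) is left, and α(W)
at g is Θ(g)(v). -/
theorem IsLeftInvariant.tderiv_coadjointOrbitMap {α : Form E G 1} (h : α.IsLeftInvariant)
    (hα : α.IsSmooth) (u v : E) :
    tderiv E (E [⋀^Fin 1]→L[ℝ] ℝ) α.coadjointOrbitMap (1 : G) u ![v] = α.d.val 1 ![u, v] := by
  have h1 := extDeriv_apply_pair hα.differentiableAt_one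
    (hasFDerivAt_leftField (G := G) u).differentiableAt
    (hasFDerivAt_rightField (G := G) v).differentiableAt
  rw [h.fderiv_leftField, leftField_one, rightField_one, lieBracket_leftField_rightField,
    ← val_d_one] at h1
  have h0 : α.inChart 1 (oneChart E G) ![(0 : E)] = 0 :=
    (α.inChart 1 (oneChart E G)).map_coord_zero (0 : Fin 1) rfl
  rw [h0, zero_apply, sub_zero, sub_zero] at h1
  rw [h1]
  have hd : DifferentiableAt ℝ
      (fun y => α.coadjointOrbitMap ((extChartAt 𝓘(ℝ, E) (1 : G)).symm y)) (oneChart E G) :=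
    hα.contDiffAt_coadjointOrbitMap_symm.differentiableAt (by simp)
  have h2 : (fun y => α.coadjointOrbitMap ((extChartAt 𝓘(ℝ, E) (1 : G)).symm y) ![v])
      =ᶠ[𝓝 (oneChart E G)] fun y => α.inChart 1 y ![rightField E G v y] :=
    coadjointOrbitMap_symm_apply α v
  rw [← h2.fderiv_eq, fderiv_continuousAlternatingMap_apply_const_apply hd]
  have h3 := tderiv_comp (F := E) (F' := E [⋀^Fin 1]→L[ℝ] ℝ) (g := (α.coadjointOrbitMap : G → _))
    (f := (extChartAt 𝓘(ℝ, E) (1 : G)).symm) (x := oneChart E G)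
    (by rw [symm_oneChart]; exact mdifferentiableAt_of_contMDiffAt
          hα.contMDiffAt_coadjointOrbitMap_one)
    (mdifferentiableAt_of_contMDiffAt (contMDiffAt_extChartAt_symm_of_mem oneChart_mem_target))
  rw [symm_oneChart, tderiv_symm_oneChart, tderiv_eq_fderiv] at h3
  exact congrArg (fun T => T u ![v]) h3.symm

/-- A smooth right `Z(G)`-invariant map to a Euclidean space, submersive at the identity, whose
derivative there has kernel `ker (dα)_1`. -/
theorem IsLeftInvariant.exists_invariant_submersion {α : Form E G 1} (h : α.IsLeftInvariant)
    (hα : α.IsSmooth) :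
    ∃ (n : ℕ) (f : G → EuclideanSpace ℝ (Fin n)),
      ContMDiff 𝓘(ℝ, E) 𝓘(ℝ, EuclideanSpace ℝ (Fin n)) ∞ f ∧
      (∀ g, ∀ z ∈ Subgroup.center G, f (g * z) = f g) ∧
      Function.Surjective (tderiv E (EuclideanSpace ℝ (Fin n)) f 1) ∧
      ∀ u, tderiv E (EuclideanSpace ℝ (Fin n)) f 1 u = 0 ↔ ∀ v, α.d.val 1 ![u, v] = 0 := by
  let T := tderiv E (E [⋀^Fin 1]→L[ℝ] ℝ) α.coadjointOrbitMap (1 : G)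
  let R := LinearMap.range T.toLinearMap
  -- Projecting onto the image R of the derivative makes the derivative surjective without enlarging
  -- its kernel.
  obtain ⟨P, hP⟩ : R.ClosedComplemented := Submodule.ClosedComplemented.of_finiteDimensional R
  let e : R ≃L[ℝ] EuclideanSpace ℝ (Fin (Module.finrank ℝ R)) := toEuclidean
  let A := e.toContinuousLinearMap.comp P
  have hf := (h.contMDiff_coadjointOrbitMap hα)
  have hA : ∀ u, A (T u) = e ⟨T u, u, rfl⟩ := fun u => congrArg e (hP ⟨T u, u, rfl⟩)
  have hd : tderiv E _ (A ∘ α.coadjointOrbitMap) (1 : G) = A.comp T := by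
    have := tderiv_comp (F' := EuclideanSpace ℝ (Fin (Module.finrank ℝ R)))
      (g := A) (f := (α.coadjointOrbitMap : G → _)) (x := 1)
      A.differentiableAt.mdifferentiableAt (mdifferentiableAt_of_contMDiffAt hf.contMDiffAt)
    rw [tderiv_eq_fderiv, A.fderiv] at this
    exact this
  refine ⟨_, A ∘ α.coadjointOrbitMap, A.contDiff.contMDiff.comp hf, fun g z hz => ?_, ?_, ?_⟩
  · simp only [Function.comp_apply, h.coadjointOrbitMap_mul_of_mem_center g hz]
  · intro w
    obtain ⟨u, hu⟩ := (e.symm w).2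
    refine ⟨u, ?_⟩
    rw [hd, ContinuousLinearMap.comp_apply, hA]
    rw [ContinuousLinearEquiv.eq_symm_apply e |>.symm]
    exact Subtype.ext hu
  · intro u
    rw [hd, ContinuousLinearMap.comp_apply, hA, map_eq_zero_iff e e.injective, Subtype.ext_iff]
    constructor
    · intro hu v
      rw [← h.tderiv_coadjointOrbitMap hα]
      exact congrArg (fun θ : E [⋀^Fin 1]→L[ℝ] ℝ => θ ![v]) hu
    · intro hu
      refine ContinuousAlternatingMap.ext fun v => ?_
      have hv : v = ![v 0] := by ext i; fin_cases i; rfl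
      rw [hv]
      exact (h.tderiv_coadjointOrbitMap hα u (v 0)).trans (hu _)

end Form

end CoadjointOrbitMap

/-! ### Closed non-discrete subgroups inside a curve. -/

section Curve

variable {G : Type*} [Group G] [TopologicalSpace G] [IsTopologicalGroup G]

theorem pos_of_pos_of_ne_zero {a b : ℝ} {f : ℝ → ℝ} (hf : ContinuousOn f (Set.Icc a b))
    (h0 : ∀ x ∈ Set.Icc a b, f x ≠ 0) {x y : ℝ} (hx : x ∈ Set.Icc a b) (hy : y ∈ Set.Icc a b)
    (h : 0 < f x) : 0 < f y := by
  by_contra hneg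
  obtain ⟨z, hz, hz0⟩ := isPreconnected_Icc.intermediate_value hy hx hf
    (show (0 : ℝ) ∈ Set.Icc (f y) (f x) from ⟨not_lt.mp hneg, h.le⟩)
  exact h0 z hz hz0

/-- A closed non-discrete subgroup which near the identity is contained in a curve contains the
curve near the identity (positive half). -/
theorem curve_mem_subgroup_of_nonneg {N : Subgroup G} (hN : IsClosed (N : Set G))
    (hacc : ∀ O ∈ 𝓝 (1 : G), ∃ z ∈ N, z ≠ 1 ∧ z ∈ O)
    {c : ℝ → G} {τ : G → ℝ} {U : Set G} (hU : IsOpen U) {δ : ℝ} (hδ : 0 < δ)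
    (hc : ∀ x ∈ Set.Icc (-δ) δ, ContinuousAt c x) (hcU : ∀ x ∈ Set.Icc (-δ) δ, c x ∈ U)
    (hτ : ContinuousOn τ U) (hτc : ∀ x ∈ Set.Icc (-δ) δ, τ (c x) = x) (hc0 : c 0 = 1)
    (hinj : ∀ g ∈ U, ∀ z ∈ N, g * z ∈ U → τ (g * z) = τ g → z = 1)
    (hcurve : ∀ z ∈ N, z ∈ U → τ z ∈ Set.Icc (-δ) δ → c (τ z) = z)
    {x₀ : ℝ} (hx₀ : x₀ ∈ Set.Icc 0 δ) : c x₀ ∈ N := by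
  by_contra hx₀N
  have h0mem : (0 : ℝ) ∈ Set.Icc (-δ) δ := ⟨by linarith, hδ.le⟩
  have h1U : (1 : G) ∈ U := hc0 ▸ hcU 0 h0mem
  have hτ1 : τ 1 = 0 := by rw [← hc0, hτc 0 h0mem]
  have hsub : Set.Icc 0 x₀ ⊆ Set.Icc (-δ) δ := fun x hx => ⟨by linarith [hx.1], hx.2.trans hx₀.2⟩
  have hcc : ContinuousOn c (Set.Icc 0 x₀) := fun x hx => (hc x (hsub hx)).continuousWithinAt
  have hScomp : IsCompact (Set.Icc 0 x₀ ∩ c ⁻¹' N) :=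
    isCompact_Icc.of_isClosed_subset (hcc.preimage_isClosed_of_isClosed isClosed_Icc hN)
      Set.inter_subset_left
  -- a is the last parameter in [0, x₀] at which the curve meets N. A small element of N will push c
  -- a strictly further along the curve, still short of x₀.
  obtain ⟨a, ⟨haI, haN⟩, hamax⟩ := hScomp.exists_isGreatest
    ⟨0, ⟨le_rfl, hx₀.1⟩, by simp [hc0]⟩
  have haδ := hsub haI
  have hax : a < x₀ := lt_of_le_of_ne haI.2 fun h => hx₀N (h ▸ haN)
  have hτat : ∀ g ∈ U, ContinuousAt τ g := fun g hg => hτ.continuousAt (hU.mem_nhds hg)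
  have hmulc : ∀ x ∈ Set.Icc (-δ) δ, ContinuousAt (fun p : G × ℝ => c p.2 * p.1) (1, x) :=
    fun x hx => ((hc x hx).comp (x := ((1 : G), x)) continuousAt_snd).mul continuousAt_fst
  -- Compactness of the interval gives one neighborhood of 1 that works for every x.
  have htube : ∀ᶠ z in 𝓝 (1 : G), ∀ x ∈ Set.Icc (-δ) δ, c x * z ∈ U := by
    refine isCompact_Icc.eventually_forall_of_forall_eventually fun x hx => ?_
    exact (hmulc x hx).eventually_mem (hU.mem_nhds (by simpa using hcU x hx))
  have hatend : ContinuousAt (fun z => τ (c a * z)) (1 : G) := by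
    refine ContinuousAt.comp (g := τ) ?_ (continuous_const_mul (c a)).continuousAt
    rw [mul_one]; exact hτat _ (hcU a haδ)
  have hev : ∀ᶠ z in 𝓝 (1 : G), (∀ x ∈ Set.Icc (-δ) δ, c x * z ∈ U) ∧
      τ (c a * z) ∈ Set.Ioo (-δ) x₀ ∧ τ z ∈ Set.Ioo (-δ) δ := by
    refine htube.and (Filter.Eventually.and ?_ ?_)
    · refine hatend.eventually_mem (isOpen_Ioo.mem_nhds ?_)
      rw [mul_one, hτc a haδ]
      exact ⟨by linarith [haI.1], hax⟩
    · refine (hτat 1 h1U).eventually_mem (isOpen_Ioo.mem_nhds ?_)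
      rw [hτ1]; exact ⟨by linarith, hδ⟩
  have hevinv : ∀ᶠ z in 𝓝 (1 : G), (∀ x ∈ Set.Icc (-δ) δ, c x * z⁻¹ ∈ U) ∧
      τ (c a * z⁻¹) ∈ Set.Ioo (-δ) x₀ ∧ τ z⁻¹ ∈ Set.Ioo (-δ) δ := by
    have : Tendsto (fun z : G => z⁻¹) (𝓝 1) (𝓝 1) := by
      have := (continuous_inv (G := G)).continuousAt (x := 1)
      rwa [ContinuousAt, inv_one] at this
    exact this.eventually hev
  obtain ⟨z₀, hz₀N, hz₀, hz₀U, hz₀inv⟩ := hacc _ (hev.and hevinv)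
  have hcont : ∀ z, (∀ x ∈ Set.Icc (-δ) δ, c x * z ∈ U) →
      ContinuousOn (fun x => τ (c x * z) - x) (Set.Icc (-δ) δ) := fun z hz x hx =>
    (((hτat _ (hz x hx)).comp (f := fun x => c x * z)
      ((hc x hx).mul continuousAt_const)).sub continuousAt_id).continuousWithinAt
  -- The displacement τ(c x · z) - x never vanishes, because right translation by z ≠ 1 fixes no
  -- value of τ. By continuity it keeps one sign, so z moves the whole curve in one direction.
  have hne : ∀ z ∈ N, z ≠ 1 → (∀ x ∈ Set.Icc (-δ) δ, c x * z ∈ U) →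
      ∀ x ∈ Set.Icc (-δ) δ, τ (c x * z) - x ≠ 0 := fun z hzN hz hzU x hx h0 =>
    hz (hinj (c x) (hcU x hx) z hzN (hzU x hx) (by rw [hτc x hx]; linarith))
  obtain ⟨z, hzN, hz, hzpos, hzU, hza, -⟩ : ∃ z ∈ N, z ≠ 1 ∧ 0 < τ z ∧
      (∀ x ∈ Set.Icc (-δ) δ, c x * z ∈ U) ∧ τ (c a * z) ∈ Set.Ioo (-δ) x₀ ∧
      τ z ∈ Set.Ioo (-δ) δ := by
    rcases lt_or_ge 0 (τ z₀) with hpos | hneg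
    · exact ⟨z₀, hz₀N, hz₀, hpos, hz₀U⟩
    -- If τ(z₀⁻¹) were also nonpositive, z₀ would move the point z₀⁻¹ of the curve forward to 1. By
    -- constancy of sign it would also move 1 forward, contradicting τ(z₀) ≤ 0.
    refine ⟨z₀⁻¹, N.inv_mem hz₀N, inv_ne_one.mpr hz₀, ?_, hz₀inv⟩
    have hxmem : τ z₀⁻¹ ∈ Set.Icc (-δ) δ := ⟨hz₀inv.2.2.1.le, hz₀inv.2.2.2.le⟩
    have hinvU : z₀⁻¹ ∈ U := by simpa [hc0] using hz₀inv.1 0 h0mem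
    have hcx := hcurve _ (N.inv_mem hz₀N) hinvU hxmem
    have hx0 := hne z₀ hz₀N hz₀ hz₀U.1 _ hxmem
    rw [hcx, inv_mul_cancel, hτ1] at hx0
    by_contra hle
    have hlt : 0 < τ (c (τ z₀⁻¹) * z₀) - τ z₀⁻¹ := by
      rw [hcx, inv_mul_cancel, hτ1]
      exact lt_of_le_of_ne (by linarith) hx0.symm
    have := pos_of_pos_of_ne_zero (hcont z₀ hz₀U.1) (hne z₀ hz₀N hz₀ hz₀U.1) hxmem h0mem hlt
    rw [hc0, one_mul] at this
    linarith
  have hpos : 0 < τ (c a * z) - a := by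
    refine pos_of_pos_of_ne_zero (hcont z hzU) (hne z hzN hz hzU) h0mem haδ ?_
    rw [hc0, one_mul]; linarith
  have hcazN : c a * z ∈ N := N.mul_mem haN hzN
  have := hcurve _ hcazN (hzU a haδ) ⟨hza.1.le, hza.2.le.trans hx₀.2⟩
  have hle := hamax (show τ (c a * z) ∈ Set.Icc 0 x₀ ∩ c ⁻¹' N from
    ⟨⟨by linarith [haI.1], hza.2.le⟩, by rw [Set.mem_preimage, this]; exact hcazN⟩)
  linarith

/-- The negative half follows from the positive one by reversing both c and τ. -/
theorem curve_mem_subgroup {N : Subgroup G} (hN : IsClosed (N : Set G))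
    (hacc : ∀ O ∈ 𝓝 (1 : G), ∃ z ∈ N, z ≠ 1 ∧ z ∈ O)
    {c : ℝ → G} {τ : G → ℝ} {U : Set G} (hU : IsOpen U) {δ : ℝ} (hδ : 0 < δ)
    (hc : ∀ x ∈ Set.Icc (-δ) δ, ContinuousAt c x) (hcU : ∀ x ∈ Set.Icc (-δ) δ, c x ∈ U)
    (hτ : ContinuousOn τ U) (hτc : ∀ x ∈ Set.Icc (-δ) δ, τ (c x) = x) (hc0 : c 0 = 1)
    (hinj : ∀ g ∈ U, ∀ z ∈ N, g * z ∈ U → τ (g * z) = τ g → z = 1)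
    (hcurve : ∀ z ∈ N, z ∈ U → τ z ∈ Set.Icc (-δ) δ → c (τ z) = z)
    {x₀ : ℝ} (hx₀ : x₀ ∈ Set.Icc (-δ) δ) : c x₀ ∈ N := by
  rcases le_total 0 x₀ with h | h
  · exact curve_mem_subgroup_of_nonneg hN hacc hU hδ hc hcU hτ hτc hc0 hinj hcurve ⟨h, hx₀.2⟩
  have hneg : ∀ x ∈ Set.Icc (-δ) δ, -x ∈ Set.Icc (-δ) δ := fun x hx =>
    ⟨by linarith [hx.2], by linarith [hx.1]⟩
  have := curve_mem_subgroup_of_nonneg (c := fun x => c (-x)) (τ := fun g => -τ g) hN hacc hU hδ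
    (fun x hx => (hc _ (hneg x hx)).comp continuousAt_neg) (fun x hx => hcU _ (hneg x hx)) hτ.neg
    (fun x hx => by rw [hτc _ (hneg x hx), neg_neg]) (by simpa using hc0)
    (fun g hg z hz hgz hτz => hinj g hg z hz hgz (neg_inj.mp hτz))
    (fun z hz hzU hτz => by
      have h2 := hneg _ hτz
      rw [neg_neg] at h2 ⊢
      exact hcurve z hz hzU h2)
    (x₀ := -x₀) ⟨by linarith, by linarith [hx₀.1]⟩
  simpa using this

end Curve

/-! ### Inverse function theorem on a manifold. -/

section Straightening

variable {E : Type*} [NormedAddCommGroup E] [NormedSpace ℝ E] [FiniteDimensional ℝ E]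
  {M : Type*} [TopologicalSpace M] [ChartedSpace E M] [IsManifold 𝓘(ℝ, E) ∞ M]
  {W : Type*} [NormedAddCommGroup W] [NormedSpace ℝ W]

/-- Inverse function theorem in the form of a local chart with smooth inverse. -/
theorem exists_openPartialHomeomorph_of_bijective {f : M → W} {x : M}
    (hf : ∀ᶠ z in 𝓝 x, ContMDiffAt 𝓘(ℝ, E) 𝓘(ℝ, W) ∞ f z)
    (hd : Function.Bijective (tderiv E W f x)) :
    ∃ Φ : OpenPartialHomeomorph M W, x ∈ Φ.source ∧ (∀ z ∈ Φ.source, Φ z = f z) ∧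
      ∀ w ∈ Φ.target, ContMDiffAt 𝓘(ℝ, W) 𝓘(ℝ, E) ∞ Φ.symm w := by
  let c := extChartAt 𝓘(ℝ, E) x
  let h : E → W := fun y => f (c.symm y)
  have hxt : c x ∈ c.target := mem_extChartAt_target x
  have hh : ∀ᶠ y in 𝓝 (c x), ContDiffAt ℝ ∞ h y := by
    have ht : Tendsto c.symm (𝓝 (c x)) (𝓝 x) := by
      have := continuousAt_extChartAt_symm (I := 𝓘(ℝ, E)) x
      rwa [ContinuousAt, extChartAt_to_inv] at this
    filter_upwards [ht.eventually hf, extChartAt_target_mem_nhds' hxt] with y hy hyt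
    exact contMDiffAt_iff_contDiffAt.mp (hy.comp y (contMDiffAt_extChartAt_symm_of_mem hyt))
  have hhx := hh.self_of_nhds
  have hdx : fderiv ℝ h (c x) = tderiv E W f x := by
    have h1 := tderiv_comp (F := E) (F' := W) (g := h) (f := c) (x := x)
      (hhx.differentiableAt (by simp)).mdifferentiableAt
      (mdifferentiableAt_of_contMDiffAt contMDiffAt_extChartAt)
    have h2 : h ∘ c =ᶠ[𝓝 x] f := by
      filter_upwards [eventually_symm_extChartAt (E := E) (mem_extChartAt_source x)] with z hz
      simp only [h, c, Function.comp_apply, hz]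
    rw [tderiv_congr h2, tderiv_extChartAt_self, tderiv_eq_fderiv] at h1
    rw [h1]; rfl
  let e₀ : E ≃ₗ[ℝ] W := LinearEquiv.ofBijective (tderiv E W f x).toLinearMap hd
  have : FiniteDimensional ℝ W := Module.Finite.equiv e₀
  let e : E ≃L[ℝ] W := e₀.toContinuousLinearEquiv
  have he : HasFDerivAt h (e : E →L[ℝ] W) (c x) := by
    have h1 := (hhx.differentiableAt (by simp)).hasFDerivAt
    rw [hdx] at h1
    exact h1
  have hinv : ∀ᶠ y in 𝓝 (c x), fderiv ℝ h y ∈ Set.range ((↑) : (E ≃L[ℝ] W) → E →L[ℝ] W) := by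
    have hcont : ContinuousAt (fderiv ℝ h) (c x) :=
      (hhx.fderiv_right (m := ∞) (by simp)).continuousAt
    refine hcont.eventually_mem ?_
    rw [he.fderiv]
    exact ContinuousLinearEquiv.nhds e
  -- The inverse must be smooth at every point of its domain, so the domain is shrunk until h is
  -- smooth with invertible derivative throughout.
  obtain ⟨O, hO, hOo, hxO⟩ := eventually_nhds_iff.mp
    (hh.and (hinv.and (extChartAt_target_mem_nhds' hxt)))
  let Φ₁ := hhx.toOpenPartialHomeomorph h he (by simp)
  let Φ₂ := Φ₁.restrOpen O hOo
  let Φ := (chartAt E x).trans Φ₂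
  refine ⟨Φ, ?_, ?_, ?_⟩
  · refine ⟨mem_chart_source E x, ?_, ?_⟩
    · exact hhx.mem_toOpenPartialHomeomorph_source he (by simp)
    · exact hxO
  · exact fun z hz => congrArg f (c.left_inv (by simpa [c] using hz.1))
  · intro w hw
    obtain ⟨hw1, hw2⟩ := hw
    have hw3 : Φ₂.symm w ∈ O := (Φ₂.map_target hw1).2
    obtain ⟨hs, ⟨e', he'⟩, ht⟩ := hO _ hw3
    have hsm : ContDiffAt ℝ ∞ Φ₂.symm w := by
      refine Φ₂.contDiffAt_symm (f₀' := e') hw1 ?_ hs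
      rw [he']
      exact (hs.differentiableAt (by simp)).hasFDerivAt
    exact ContMDiffAt.comp (g := c.symm) (f := Φ₂.symm) w (contMDiffAt_extChartAt_symm_of_mem ht)
      (contMDiffAt_iff_contDiffAt.mpr hsm)

end Straightening

/-! ### Quotient Lie group structure from an invariant submersion. -/

section QuotientChart

variable (E : Type*) [NormedAddCommGroup E] [NormedSpace ℝ E]
  (V : Type*) [NormedAddCommGroup V] [NormedSpace ℝ V]
  {G : Type*} [TopologicalSpace G] [ChartedSpace E G] [Group G]

/-- A smooth right `N`-invariant map `f` to a vector space together with a local smooth section `σ`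
near the identity, such that `σ ∘ f` is the identity modulo `N` near the identity. -/
structure QuotientChart (N : Subgroup G) where
  /-- the invariant map -/
  f : G → V
  /-- the local section -/
  σ : V → G
  /-- a neighbourhood of the identity -/
  U : Set G
  /-- the domain of the section -/
  B : Set V
  contMDiff_f : ContMDiff 𝓘(ℝ, E) 𝓘(ℝ, V) ∞ f
  f_mul : ∀ g, ∀ z ∈ N, f (g * z) = f g
  isOpen_U : IsOpen U
  one_mem : 1 ∈ U
  isOpen_B : IsOpen B
  contMDiffOn_σ : ContMDiffOn 𝓘(ℝ, V) 𝓘(ℝ, E) ∞ σ B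
  σ_f_one : σ (f 1) = 1
  mapsTo_f : Set.MapsTo f U B
  f_σ : ∀ s ∈ B, f (σ s) = s
  σ_f : ∀ g ∈ U, ∃ z ∈ N, g = σ (f g) * z

variable {E V}

/-- A coordinate τ with differential l completes f to a local diffeomorphism (f, τ). The fiber of f
through 1 then lies in N near 1, and the slice τ = 0 provides the section. -/
theorem exists_quotientChart [FiniteDimensional ℝ E] [LieGroup 𝓘(ℝ, E) ∞ G] {N : Subgroup G}
    (hN : IsClosed (N : Set G)) (hacc : ∀ O ∈ 𝓝 (1 : G), ∃ z ∈ N, z ≠ 1 ∧ z ∈ O)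
    {f : G → V} (hf : ContMDiff 𝓘(ℝ, E) 𝓘(ℝ, V) ∞ f) (hfN : ∀ g, ∀ z ∈ N, f (g * z) = f g)
    (hsurj : Function.Surjective (tderiv E V f 1)) {k : E} {l : E →L[ℝ] ℝ}
    (hk : tderiv E V f 1 k = 0) (hlk : l k = 1)
    (hker : ∀ u, tderiv E V f 1 u = 0 → l u = 0 → u = 0) :
    ∃ D : QuotientChart E V N, D.f = f := by
  have : IsTopologicalGroup G := topologicalGroup_of_lieGroup 𝓘(ℝ, E) ∞
  let τ : G → ℝ := fun g => l (extChartAt 𝓘(ℝ, E) (1 : G) g - extChartAt 𝓘(ℝ, E) (1 : G) 1)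
  have hτ : ∀ᶠ z in 𝓝 (1 : G), ContMDiffAt 𝓘(ℝ, E) 𝓘(ℝ, ℝ) ∞ τ z := by
    filter_upwards [extChartAt_source_mem_nhds (I := 𝓘(ℝ, E)) (1 : G)] with z hz
    have h1 : ContDiff ℝ ∞ fun y : E => l (y - extChartAt 𝓘(ℝ, E) (1 : G) 1) :=
      l.contDiff.comp (contDiff_id.sub contDiff_const)
    exact h1.contMDiff.contMDiffAt.comp z (contMDiffAt_extChartAt_of_mem hz)
  have hdτ : ∀ u, tderiv E ℝ τ 1 u = l u := fun u => by
    have h1 : HasFDerivAt (fun y : E => l (y - extChartAt 𝓘(ℝ, E) (1 : G) 1)) l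
        (extChartAt 𝓘(ℝ, E) (1 : G) 1) :=
      l.hasFDerivAt.comp _ ((hasFDerivAt_id _).sub_const _)
    have h2 := tderiv_comp (F := E) (F' := ℝ) (x := (1 : G)) (f := extChartAt 𝓘(ℝ, E) (1 : G))
      h1.differentiableAt.mdifferentiableAt
      (mdifferentiableAt_of_contMDiffAt contMDiffAt_extChartAt)
    rw [tderiv_extChartAt_self, tderiv_eq_fderiv, h1.fderiv] at h2
    exact congrArg (fun T => T u) h2
  let Ψ : G → V × ℝ := fun g => (f g, τ g)
  have hΨ : ∀ᶠ z in 𝓝 (1 : G), ContMDiffAt 𝓘(ℝ, E) 𝓘(ℝ, V × ℝ) ∞ Ψ z := by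
    filter_upwards [hτ] with z hz using hf.contMDiffAt.prodMk_space hz
  have hΨ1 := mdifferentiableAt_of_contMDiffAt hΨ.self_of_nhds
  have hdΨ : ∀ u, tderiv E (V × ℝ) Ψ 1 u = (tderiv E V f 1 u, l u) := fun u => by
    refine Prod.ext ?_ ?_
    · have h2 := tderiv_comp (F := V × ℝ) (F' := V) (x := (1 : G)) (f := Ψ)
        (ContinuousLinearMap.fst ℝ V ℝ).differentiableAt.mdifferentiableAt hΨ1
      rw [tderiv_eq_fderiv, ContinuousLinearMap.fderiv] at h2
      exact (congrArg (fun T => T u) h2).symm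
    · have h2 := tderiv_comp (F := V × ℝ) (F' := ℝ) (x := (1 : G)) (f := Ψ)
        (ContinuousLinearMap.snd ℝ V ℝ).differentiableAt.mdifferentiableAt hΨ1
      rw [tderiv_eq_fderiv, ContinuousLinearMap.fderiv] at h2
      rw [← hdτ]
      exact (congrArg (fun T => T u) h2).symm
  have hbij : Function.Bijective (tderiv E (V × ℝ) Ψ 1) := by
    constructor
    · refine (injective_iff_map_eq_zero _).mpr fun u hu => ?_
      rw [hdΨ, Prod.mk_eq_zero] at hu
      exact hker u hu.1 hu.2
    · rintro ⟨w, r⟩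
      obtain ⟨u, hu⟩ := hsurj w
      refine ⟨u + (r - l u) • k, ?_⟩
      rw [hdΨ]
      simp [hu, hk, hlk]
  obtain ⟨Φ, h1Φ, hΦ, hΦs⟩ := exists_openPartialHomeomorph_of_bijective hΨ hbij
  have hτ1 : τ 1 = 0 := by simp [τ]
  have hΨone : Φ 1 = (f 1, 0) := by rw [hΦ 1 h1Φ]; simp only [Ψ, hτ1]
  have hsymm1 : Φ.symm (f 1, 0) = 1 := by rw [← hΨone, Φ.left_inv h1Φ]
  have hft : ∀ w ∈ Φ.target, f (Φ.symm w) = w.1 ∧ τ (Φ.symm w) = w.2 := fun w hw => by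
    have h1 := Φ.right_inv hw
    rw [hΦ _ (Φ.map_target hw)] at h1
    exact ⟨congrArg Prod.fst h1, congrArg Prod.snd h1⟩
  have huniq : ∀ g ∈ Φ.source, ∀ g' ∈ Φ.source, f g = f g' → τ g = τ g' → g = g' :=
    fun g hg g' hg' h1 h2 => Φ.injOn hg hg' (by rw [hΦ g hg, hΦ g' hg']; simp only [Ψ, h1, h2])
  have hτU : ContinuousOn τ Φ.source := by
    have h1 : ContinuousOn (fun g => (Φ g).2) Φ.source := continuous_snd.comp_continuousOn
      Φ.continuousOn
    exact h1.congr fun g hg => (congrArg Prod.snd (hΦ g hg)).symm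
  have hf1t : (f 1, (0 : ℝ)) ∈ Φ.target := hΨone ▸ Φ.map_source h1Φ
  obtain ⟨δ, hδ, hδt⟩ : ∃ δ > 0, ∀ x ∈ Set.Icc (-δ) δ, (f 1, x) ∈ Φ.target := by
    have h1 : ∀ᶠ x in 𝓝 (0 : ℝ), (f 1, x) ∈ Φ.target :=
      (Continuous.prodMk_right (f 1)).continuousAt.eventually_mem (Φ.open_target.mem_nhds hf1t)
    obtain ⟨ε, hε, hb⟩ := Metric.eventually_nhds_iff_ball.mp h1
    refine ⟨ε / 2, half_pos hε, fun x hx => hb x ?_⟩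
    rw [Metric.mem_ball, Real.dist_eq, sub_zero, abs_lt]
    constructor <;> linarith [hx.1, hx.2]
  let c : ℝ → G := fun x => Φ.symm (f 1, x)
  have hcc : ∀ x ∈ Set.Icc (-δ) δ, ContinuousAt c x := fun x hx =>
    ContinuousAt.comp (g := Φ.symm) (Φ.symm.continuousAt (hδt x hx))
      (Continuous.prodMk_right (f 1)).continuousAt
  have hcU : ∀ x ∈ Set.Icc (-δ) δ, c x ∈ Φ.source := fun x hx => Φ.map_target (hδt x hx)
  -- Both hypotheses of the curve lemma come from injectivity of (f, τ): f is N-invariant, so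
  -- elements g and gz, or z and a point of the curve, are separated by τ alone.
  have hcN : ∀ x ∈ Set.Icc (-δ) δ, c x ∈ N := fun x hx => by
    refine curve_mem_subgroup hN hacc Φ.open_source hδ hcc hcU hτU
      (fun x hx => (hft _ (hδt x hx)).2) hsymm1 (fun g hg z hz hgz hτz => ?_)
      (fun z hz hzU hτz => ?_) hx
    · exact mul_eq_left.mp (huniq _ hgz _ hg (hfN g z hz) hτz)
    · refine huniq _ (hcU _ hτz) _ hzU ?_ (hft _ (hδt _ hτz)).2
      rw [(hft _ (hδt _ hτz)).1]
      simpa using (hfN 1 z hz).symm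
  -- At s = f 1 the translated curve is c itself, where τ(c x) = x. For nearby s the error is below
  -- δ/2, uniformly in x by compactness.
  have hev : ∀ᶠ s in 𝓝 (f 1), (s, (0 : ℝ)) ∈ Φ.target ∧ ∀ x ∈ Set.Icc (-δ) δ,
      Φ.symm (s, 0) * c x ∈ Φ.source ∧ |τ (Φ.symm (s, 0) * c x) - x| < δ / 2 := by
    refine Filter.Eventually.and ?_ ?_
    · exact (Continuous.prodMk_left (0 : ℝ)).continuousAt.eventually_mem
        (Φ.open_target.mem_nhds hf1t)
    refine isCompact_Icc.eventually_forall_of_forall_eventually fun x hx => ?_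
    have hm : ContinuousAt (fun p : V × ℝ => Φ.symm (p.1, 0) * c p.2) (f 1, x) := by
      refine ContinuousAt.mul ?_ ?_
      · exact ContinuousAt.comp (g := Φ.symm) (f := fun p : V × ℝ => (p.1, (0 : ℝ)))
          (Φ.symm.continuousAt hf1t) (continuousAt_fst.prodMk continuousAt_const)
      · exact ContinuousAt.comp (g := c) (f := fun p : V × ℝ => p.2) (x := (f 1, x)) (hcc x hx)
          continuousAt_snd
    have hv : Φ.symm (f 1, 0) * c x = c x := by rw [hsymm1, one_mul]
    have hmτ : ContinuousAt (fun p : V × ℝ => |τ (Φ.symm (p.1, 0) * c p.2) - p.2|) (f 1, x) := by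
      refine (ContinuousAt.sub (ContinuousAt.comp (g := τ) ?_ hm) continuousAt_snd).abs
      rw [hv]
      exact hτU.continuousAt (Φ.open_source.mem_nhds (hcU x hx))
    refine Filter.Eventually.and ?_ ?_
    · refine hm.eventually_mem (Φ.open_source.mem_nhds ?_)
      rw [hv]; exact hcU x hx
    · refine hmτ.eventually_lt continuousAt_const ?_
      rw [hv, (hft _ (hδt x hx)).2]
      simpa using half_pos hδ
  obtain ⟨B, hB, hBo, h1B⟩ := eventually_nhds_iff.mp hev
  have hUo : IsOpen (Φ.source ∩ τ ⁻¹' Set.Ioo (-(δ / 2)) (δ / 2)) :=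
    hτU.isOpen_inter_preimage Φ.open_source isOpen_Ioo
  refine ⟨{ f := f
            σ := fun s => Φ.symm (s, 0)
            U := (Φ.source ∩ τ ⁻¹' Set.Ioo (-(δ / 2)) (δ / 2)) ∩ f ⁻¹' B
            B := B
            contMDiff_f := hf
            f_mul := hfN
            isOpen_U := hUo.inter (hBo.preimage hf.continuous)
            one_mem := ?_
            isOpen_B := hBo
            contMDiffOn_σ := fun s hs => ?_
            σ_f_one := hsymm1
            mapsTo_f := fun g hg => hg.2
            f_σ := fun s hs => (hft _ (hB s hs).1).1
            σ_f := fun g hg => ?_ }, rfl⟩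
  · refine ⟨⟨h1Φ, ?_⟩, h1B⟩
    rw [Set.mem_preimage, hτ1]
    constructor <;> linarith
  · have h1 : ContDiff ℝ ∞ fun s : V => (s, (0 : ℝ)) := contDiff_id.prodMk contDiff_const
    exact (ContMDiffAt.comp (g := Φ.symm) s (hΦs _ (hB s hs).1)
      h1.contMDiff.contMDiffAt).contMDiffWithinAt
  · obtain ⟨⟨hgΦ, hgτ⟩, hgB⟩ := hg
    obtain ⟨hst, hsx⟩ := hB _ hgB
    have hcont : ContinuousOn (fun x => τ (Φ.symm (f g, 0) * c x)) (Set.Icc (-δ) δ) := by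
      refine hτU.comp (fun x hx => ?_) fun x hx => (hsx x hx).1
      exact (continuousAt_const.mul (hcc x hx)).continuousWithinAt
    have hl : -δ ∈ Set.Icc (-δ) δ := ⟨le_rfl, by linarith⟩
    have hr : δ ∈ Set.Icc (-δ) δ := ⟨by linarith, le_rfl⟩
    -- The endpoint values lie beyond -δ/2 and δ/2, while τ g lies between these, so some x gives
    -- the same τ as g. The values of f agree because c x ∈ N.
    obtain ⟨x, hx, hxτ⟩ := isPreconnected_Icc.intermediate_value hl hr hcont
      (show τ g ∈ Set.Icc _ _ from ⟨by
        have := (abs_lt.mp (hsx _ hl).2).2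
        linarith [hgτ.1], by
        have := (abs_lt.mp (hsx _ hr).2).1
        linarith [hgτ.2]⟩)
    refine ⟨c x, hcN x hx, huniq _ hgΦ _ (hsx x hx).1 ?_ hxτ.symm⟩
    rw [hfN _ _ (hcN x hx), (hft _ hst).1]

namespace QuotientChart

variable [LieGroup 𝓘(ℝ, E) ∞ G] {N : Subgroup G} [N.Normal] (D : QuotientChart E V N)

/-- The map induced on the quotient. -/
def lift : G ⧸ N → V :=
  Quotient.lift D.f fun a b h => by
    have h1 := QuotientGroup.leftRel_apply.mp h
    rw [← D.f_mul a _ h1, mul_inv_cancel_left]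

theorem continuous_lift : Continuous D.lift := D.contMDiff_f.continuous.quotient_lift _

/-- The induced chart of the quotient at the identity. -/
def chart [IsTopologicalGroup G] : OpenPartialHomeomorph (G ⧸ N) V where
  toFun := D.lift
  invFun s := QuotientGroup.mk (D.σ s)
  source := QuotientGroup.mk '' D.U
  target := D.B ∩ (fun s => (QuotientGroup.mk (D.σ s) : G ⧸ N)) ⁻¹' (QuotientGroup.mk '' D.U)
  map_source' := by
    rintro _ ⟨g, hg, rfl⟩
    refine ⟨D.mapsTo_f hg, g, hg, ?_⟩
    obtain ⟨z, hz, h⟩ := D.σ_f g hg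
    change (QuotientGroup.mk g : G ⧸ N) = QuotientGroup.mk (D.σ (D.f g))
    conv_lhs => rw [h]
    exact QuotientGroup.mk_mul_of_mem _ hz
  map_target' := fun s hs => hs.2
  left_inv' := by
    rintro _ ⟨g, hg, rfl⟩
    obtain ⟨z, hz, h⟩ := D.σ_f g hg
    change (QuotientGroup.mk (D.σ (D.f g)) : G ⧸ N) = QuotientGroup.mk g
    conv_rhs => rw [h]
    exact (QuotientGroup.mk_mul_of_mem _ hz).symm
  right_inv' := fun s hs => D.f_σ s hs.1
  open_source := QuotientGroup.isOpenMap_coe _ D.isOpen_U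
  open_target := (QuotientGroup.continuous_mk.comp_continuousOn
    D.contMDiffOn_σ.continuousOn).isOpen_inter_preimage D.isOpen_B
      (QuotientGroup.isOpenMap_coe _ D.isOpen_U)
  continuousOn_toFun := D.continuous_lift.continuousOn
  continuousOn_invFun := (QuotientGroup.continuous_mk.comp_continuousOn
    D.contMDiffOn_σ.continuousOn).mono Set.inter_subset_left

theorem one_mem_chart_source [IsTopologicalGroup G] : 1 ∈ D.chart.source := ⟨1, D.one_mem, rfl⟩

/-- The charts of the quotient: left translates of the chart at the identity. -/
abbrev chartedSpace [IsTopologicalGroup G] : ChartedSpace V (G ⧸ N) where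
  atlas := Set.range fun q : G ⧸ N => (Homeomorph.mulLeft q⁻¹).transOpenPartialHomeomorph D.chart
  chartAt q := (Homeomorph.mulLeft q⁻¹).transOpenPartialHomeomorph D.chart
  mem_chart_source q := by
    change q⁻¹ * q ∈ D.chart.source
    rw [inv_mul_cancel]; exact D.one_mem_chart_source
  chart_mem_atlas q := ⟨q, rfl⟩

/-- Transition maps pass through G: they have the form s ↦ f(h⁻¹ g σ(s)), with g and h representing
the two base points. -/
theorem isManifold [IsTopologicalGroup G] :
    letI := D.chartedSpace
    IsManifold 𝓘(ℝ, V) ∞ (G ⧸ N) := by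
  let _ := D.chartedSpace
  refine isManifold_of_contDiffOn _ _ _ ?_
  rintro _ _ ⟨q, rfl⟩ ⟨r, rfl⟩
  obtain ⟨g, rfl⟩ := QuotientGroup.mk_surjective q
  obtain ⟨h, rfl⟩ := QuotientGroup.mk_surjective r
  have h1 : ContMDiffOn 𝓘(ℝ, V) 𝓘(ℝ, V) ∞ (fun s => D.f (h⁻¹ * (g⁻¹⁻¹ * D.σ s))) D.B :=
    D.contMDiff_f.comp_contMDiffOn ((contMDiff_mulLeft (E := E) h⁻¹).comp_contMDiffOn
      ((contMDiff_mulLeft (E := E) g⁻¹⁻¹).comp_contMDiffOn D.contMDiffOn_σ))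
  refine (contMDiffOn_iff_contDiffOn.mp h1).mono fun s hs => ?_
  exact hs.1.1.1

theorem contMDiff_mk [IsTopologicalGroup G] :
    letI := D.chartedSpace
    ContMDiff 𝓘(ℝ, E) 𝓘(ℝ, V) ∞ (QuotientGroup.mk : G → G ⧸ N) := by
  let _ := D.chartedSpace
  intro g
  refine contMDiffAt_iff_target.mpr ⟨QuotientGroup.continuous_mk.continuousAt, ?_⟩
  exact (D.contMDiff_f.comp (contMDiff_mulLeft g⁻¹)).contMDiffAt

/-- A translate of σ. Such sections lift the group operations of the quotient to G, where smoothness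
is known, and they show that the projection is submersive. -/
theorem exists_section [IsTopologicalGroup G] (g : G) :
    letI := D.chartedSpace
    ∃ s : G ⧸ N → G, ContMDiffAt 𝓘(ℝ, V) 𝓘(ℝ, E) ∞ s (QuotientGroup.mk g) ∧
      s (QuotientGroup.mk g) = g ∧ ∀ᶠ x in 𝓝 (QuotientGroup.mk g : G ⧸ N),
        QuotientGroup.mk (s x) = x := by
  let _ := D.chartedSpace
  have := D.isManifold
  let q : G ⧸ N := QuotientGroup.mk g
  have hq : extChartAt 𝓘(ℝ, V) q q = D.f 1 := by
    change D.lift (q⁻¹ * q) = D.f 1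
    rw [inv_mul_cancel]; rfl
  refine ⟨fun x => g * D.σ (extChartAt 𝓘(ℝ, V) q x), ?_, ?_, ?_⟩
  · refine (contMDiff_mulLeft g).contMDiffAt.comp q (ContMDiffAt.comp q (g := D.σ) ?_
      contMDiffAt_extChartAt)
    rw [hq]
    exact D.contMDiffOn_σ.contMDiffAt (D.isOpen_B.mem_nhds (D.mapsTo_f D.one_mem))
  · change g * D.σ (extChartAt 𝓘(ℝ, V) q q) = g
    rw [hq, D.σ_f_one, mul_one]
  · have h1 : ∀ᶠ x in 𝓝 q, q⁻¹ * x ∈ D.chart.source := by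
      refine (continuous_const_mul q⁻¹).continuousAt.eventually_mem
        (D.chart.open_source.mem_nhds ?_)
      rw [inv_mul_cancel]; exact D.one_mem_chart_source
    filter_upwards [h1] with x hx
    have h2 : (QuotientGroup.mk (D.σ (D.lift (q⁻¹ * x))) : G ⧸ N) = q⁻¹ * x := D.chart.left_inv hx
    change q * QuotientGroup.mk (D.σ (D.lift (q⁻¹ * x))) = x
    rw [h2, mul_inv_cancel_left]

theorem isQuotientLieGroup [IsTopologicalGroup G] :
    letI := D.chartedSpace
    IsQuotientLieGroup E V N := by
  let _ := D.chartedSpace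
  have := D.isManifold
  refine ⟨{ contMDiff_mul := ?_, contMDiff_inv := ?_ }, D.contMDiff_mk, fun g => ?_⟩
  · rintro ⟨p, q⟩
    obtain ⟨g, rfl⟩ := QuotientGroup.mk_surjective p
    obtain ⟨h, rfl⟩ := QuotientGroup.mk_surjective q
    obtain ⟨s, hs, -, hsπ⟩ := D.exists_section g
    obtain ⟨t, ht, -, htπ⟩ := D.exists_section h
    have hm : ContMDiffAt (𝓘(ℝ, V).prod 𝓘(ℝ, V)) 𝓘(ℝ, V) ∞
        (fun x : (G ⧸ N) × (G ⧸ N) => (QuotientGroup.mk (s x.1 * t x.2) : G ⧸ N))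
        (QuotientGroup.mk g, QuotientGroup.mk h) := by
      refine D.contMDiff_mk.contMDiffAt.comp _ (ContMDiffAt.mul ?_ ?_)
      · exact ContMDiffAt.comp (g := s) _ hs contMDiffAt_fst
      · exact ContMDiffAt.comp (g := t) _ ht contMDiffAt_snd
    refine hm.congr_of_eventuallyEq ?_
    filter_upwards [continuousAt_fst.eventually hsπ, continuousAt_snd.eventually htπ] with x h1 h2
    rw [QuotientGroup.mk_mul, h1, h2]
  · intro p
    obtain ⟨g, rfl⟩ := QuotientGroup.mk_surjective p
    obtain ⟨s, hs, -, hsπ⟩ := D.exists_section g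
    refine (D.contMDiff_mk.contMDiffAt.comp _ hs.inv).congr_of_eventuallyEq ?_
    filter_upwards [hsπ] with x h1
    rw [Function.comp_apply, QuotientGroup.mk_inv, h1]
  · obtain ⟨s, hs, hsg, hsπ⟩ := D.exists_section g
    have h1 := tderiv_comp (F := E) (F' := V) (g := (QuotientGroup.mk : G → G ⧸ N)) (f := s)
      (x := (QuotientGroup.mk g : G ⧸ N))
      (mdifferentiableAt_of_contMDiffAt D.contMDiff_mk.contMDiffAt)
      (mdifferentiableAt_of_contMDiffAt hs)
    have h2 : tderiv V V ((QuotientGroup.mk : G → G ⧸ N) ∘ s) (QuotientGroup.mk g) =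
        ContinuousLinearMap.id ℝ V := (tderiv_congr hsπ).trans (tderiv_id _)
    rw [hsg, h2] at h1
    intro v
    exact ⟨tderiv V E s (QuotientGroup.mk g) v, (congrArg (fun T => T v) h1).symm⟩

/-- In the chart at the identity coset the projection is f itself. This gives one inclusion of
kernels; a dimension count will make it an equality. -/
theorem tderiv_f_eq_zero [IsTopologicalGroup G] :
    letI := D.chartedSpace
    ∀ u : E, tderiv E V (QuotientGroup.mk : G → G ⧸ N) 1 u = 0 → tderiv E V D.f 1 u = 0 := by
  let _ := D.chartedSpace
  have := D.isManifold
  intro u hu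
  have hq : ContMDiffAt 𝓘(ℝ, V) 𝓘(ℝ, V) ∞ (extChartAt 𝓘(ℝ, V) (QuotientGroup.mk 1 : G ⧸ N))
    (QuotientGroup.mk 1 : G ⧸ N) := contMDiffAt_extChartAt
  have h1 := tderiv_comp (F := V) (F' := V) (f := (QuotientGroup.mk : G → G ⧸ N)) (x := (1 : G))
    (mdifferentiableAt_of_contMDiffAt hq)
    (mdifferentiableAt_of_contMDiffAt D.contMDiff_mk.contMDiffAt)
  have h2 : extChartAt 𝓘(ℝ, V) (QuotientGroup.mk 1 : G ⧸ N) ∘ QuotientGroup.mk = D.f := by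
    funext g
    change D.lift ((QuotientGroup.mk 1)⁻¹ * QuotientGroup.mk g) = D.f g
    rw [QuotientGroup.mk_one, inv_one, one_mul]; rfl
  rw [h2] at h1
  rw [h1, ContinuousLinearMap.comp_apply, hu, map_zero]

end QuotientChart

end QuotientChart

/-! ### Pullback along homomorphisms and descent of dα. -/

section Homomorphisms

variable {E : Type*} [NormedAddCommGroup E] [NormedSpace ℝ E]
  {G : Type*} [TopologicalSpace G] [ChartedSpace E G] [Group G] [LieGroup 𝓘(ℝ, E) ∞ G]
  {V : Type*} [NormedAddCommGroup V] [NormedSpace ℝ V]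
  {Q : Type*} [TopologicalSpace Q] [ChartedSpace V Q] [Group Q] [LieGroup 𝓘(ℝ, V) ∞ Q]

namespace Form

theorem IsLeftInvariant.pullback {k : ℕ} {η : Form V Q k} (h : η.IsLeftInvariant) {π : G →* Q}
    (hπ : ContMDiff 𝓘(ℝ, E) 𝓘(ℝ, V) ∞ π) : (η.pullback π : Form E G k).IsLeftInvariant := fun g => by
  have hπd := hπ.mdifferentiable (n := ∞) (by simp)
  conv_rhs => rw [← h (π g)]
  rw [pullback_pullback _ hπd (mdifferentiable_mulLeft g),
    pullback_pullback _ (mdifferentiable_mulLeft (π g)) hπd]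
  congr 1
  funext x
  simp

theorem IsLeftInvariant.isSymplectic_of_one {Ω : Form V Q 2} (h : Ω.IsLeftInvariant)
    (hΩ : Ω.IsSmooth) (hd : Ω.d = 0)
    (hnd : ∀ u, (∀ v, Ω.val 1 ![u, v] = 0) → u = 0) : Ω.IsSymplectic := by
  refine ⟨hΩ, hd, fun x u hu => ?_⟩
  have hL : ∀ v, tderiv V V (fun y => x⁻¹ * y) x (tderiv V V (fun y => x * y) 1 v) = v := by
    intro v
    have h1 := tderiv_comp (F := V) (F' := V) (f := fun y => x * y) (x := (1 : Q))
      (mdifferentiable_mulLeft x⁻¹ (x * 1)) (mdifferentiable_mulLeft x 1)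
    have h2 : (fun y => x⁻¹ * y) ∘ (fun y => x * y) = id := by funext y; simp
    rw [h2, tderiv_id, mul_one] at h1
    exact (congrArg (fun T => T v) h1).symm
  have hL' : ∀ v, tderiv V V (fun y => x * y) 1 (tderiv V V (fun y => x⁻¹ * y) x v) = v := by
    intro v
    have h1 := tderiv_comp (F := V) (F' := V) (f := fun y => x⁻¹ * y) (x := x)
      (mdifferentiable_mulLeft x (x⁻¹ * x)) (mdifferentiable_mulLeft x⁻¹ x)
    have h2 : (fun y => x * y) ∘ (fun y => x⁻¹ * y) = id := by funext y; simp
    rw [h2, tderiv_id, inv_mul_cancel] at h1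
    exact (congrArg (fun T => T v) h1).symm
  have h0 : tderiv V V (fun y => x⁻¹ * y) x u = 0 := by
    refine hnd _ fun v => ?_
    have h1 := hu (tderiv V V (fun y => x * y) 1 v)
    change Ω.val x ![u, tderiv V V (fun y => x * y) 1 v] = 0 at h1
    rw [h.val_eq x, ContinuousAlternatingMap.compContinuousLinearMap_apply] at h1
    rw [← h1]
    congr 1
    ext i
    fin_cases i
    · rfl
    · exact (hL v).symm
  rw [← hL' u, h0, map_zero]
  rfl

/-- A left invariant exact `2`-form descends to a symplectic form on a quotient by the
characteristic directions. -/
theorem IsLeftInvariant.exists_symplectic [FiniteDimensional ℝ V] {α : Form E G 1}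
    (h : α.IsLeftInvariant) (hα : α.IsSmooth) {π : G →* Q}
    (hπ : ContMDiff 𝓘(ℝ, E) 𝓘(ℝ, V) ∞ π) (hπs : Function.Surjective π)
    (hdπ : ∀ g, Function.Surjective (tderiv E V π g))
    (hker : ∀ u, tderiv E V π 1 u = 0 ↔ ∀ v, α.d.val 1 ![u, v] = 0) :
    ∃ Ω : Form V Q 2, Ω.IsLeftInvariant ∧ Ω.IsSymplectic ∧ Ω.pullback π = -α.d := by
  -- A linear lift T of tangent vectors defines Ω at the identity. By `hTπ` the ambiguity of the
  -- lift lies in ker dα and does not matter.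
  obtain ⟨T₀, hT₀⟩ := (tderiv E V π 1).toLinearMap.exists_rightInverse_of_surjective
    (LinearMap.range_eq_top.mpr (hdπ 1))
  let T : V →L[ℝ] E := LinearMap.toContinuousLinearMap T₀
  have hT : ∀ w, tderiv E V π 1 (T w) = w := fun w => congrArg (fun S => S w) hT₀
  let Ω : Form V Q 2 := leftInvariant Q ((-α.d).val 1 |>.compContinuousLinearMap T)
  have hΩ : Ω.IsLeftInvariant := isLeftInvariant_leftInvariant _
  have hΩs : Ω.IsSmooth := isSmooth_leftInvariant _
  have hTπ : ∀ u v : E, α.d.val 1 ![T (tderiv E V π 1 u), T (tderiv E V π 1 v)] =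
      α.d.val 1 ![u, v] := fun u v => by
    have h1 : ∀ u v, α.d.val 1 ![T (tderiv E V π 1 u), v] = α.d.val 1 ![u, v] := fun u v => by
      have h2 : tderiv E V π 1 (T (tderiv E V π 1 u) - u) = 0 := by
        rw [map_sub, hT, sub_self]
      have h3 := (hker _).mp h2 v
      have h4 := (toBilin (α.d.val 1).toAlternatingMap).map_sub (T (tderiv E V π 1 u)) u
      have h5 := congrArg (fun S => S v) h4
      exact sub_eq_zero.mp (h5.symm.trans h3)
    have hs : ∀ u v, α.d.val 1 ![v, u] = -α.d.val 1 ![u, v] := fun u v =>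
      map_pair_swap (α.d.val 1).toAlternatingMap u v
    rw [h1, hs, h1, ← hs]
  have hpull : Ω.pullback π = -α.d := by
    refine (hΩ.pullback hπ).ext (h.d hα).neg ?_
    rw [val_pullback, map_one, val_one_leftInvariant]
    ext v
    have h1 := hTπ (v 0) (v 1)
    have h2 : v = ![v 0, v 1] := by ext i; fin_cases i <;> rfl
    have h3 : (fun i => T (tderiv E V π 1 (v i))) =
        ![T (tderiv E V π 1 (v 0)), T (tderiv E V π 1 (v 1))] := by
      ext i; fin_cases i <;> rfl
    change -(α.d.val 1 fun i => T (tderiv E V π 1 (v i))) = -α.d.val 1 v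
    rw [h3, h1, ← h2]
  refine ⟨Ω, hΩ, hΩ.isSymplectic_of_one hΩs ?_ fun u hu => ?_, hpull⟩
  · refine ext_val fun x => ?_
    obtain ⟨g, rfl⟩ := hπs x
    have h1 : (Ω.pullback π : Form E G 2).d = 0 := by
      rw [hpull, d_neg, d_d hα, neg_zero]
    rw [d_pullback hΩs hπ] at h1
    ext v
    -- Every vector on the quotient lifts through dπ, so dΩ = 0 can be tested after pullback, where
    -- it reads d(-dα) = 0.
    choose w hw using fun i => hdπ g (v i)
    have h2 := congrArg (fun θ : Form E G 3 => θ.val g w) h1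
    change Ω.d.val (π g) (fun i => tderiv E V π g (w i)) = 0 at h2
    simp only [hw] at h2
    exact h2
  · rw [← hT u]
    refine (hker _).mpr fun v => ?_
    have h1 := hu (tderiv E V π 1 v)
    rw [val_one_leftInvariant] at h1
    have h3 : (fun i => T (![u, tderiv E V π 1 v] i)) = ![T u, T (tderiv E V π 1 v)] := by
      ext i; fin_cases i <;> rfl
    change -(α.d.val 1 fun i => T (![u, tderiv E V π 1 v] i)) = 0 at h1
    rw [h3, neg_eq_zero] at h1
    have h2 := hTπ (T u) v
    rw [hT, h1] at h2
    exact h2.symm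

end Form

end Homomorphisms

/-! ### Part (a): the quotient by the center. -/

section Quotient

variable {E : Type*} [NormedAddCommGroup E] [NormedSpace ℝ E] [FiniteDimensional ℝ E]
  {G : Type*} [TopologicalSpace G] [ChartedSpace E G] [Group G] [LieGroup 𝓘(ℝ, E) ∞ G]

/-- Charts make G a T1 space, and a T1 topological group is Hausdorff, so commuting with a given
element is a closed condition. -/
theorem isClosed_center_of_lieGroup (E : Type*) [NormedAddCommGroup E] [NormedSpace ℝ E]
    [ChartedSpace E G] [LieGroup 𝓘(ℝ, E) ∞ G] : IsClosed (Subgroup.center G : Set G) := by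
  have : IsTopologicalGroup G := topologicalGroup_of_lieGroup 𝓘(ℝ, E) ∞
  have : T1Space G := ChartedSpace.t1Space E G
  have h : (Subgroup.center G : Set G) = ⋂ g : G, {z | g * z = z * g} := by
    ext z; simp [Subgroup.mem_center_iff]
  rw [h]
  exact isClosed_iInter fun g => isClosed_eq (continuous_const_mul g) (continuous_mul_const g)

theorem exists_ne_one_mem_of_not_discrete [IsTopologicalGroup G] {N : Subgroup G}
    (h : ¬DiscreteTopology N) : ∀ O ∈ 𝓝 (1 : G), ∃ z ∈ N, z ≠ 1 ∧ z ∈ O := by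
  intro O hO
  by_contra! hne
  refine h (discreteTopology_of_isOpen_singleton_one ?_)
  obtain ⟨O', hO', hO'o, h1⟩ := mem_nhds_iff.mp hO
  refine isOpen_induced_iff.mpr ⟨O', hO'o, ?_⟩
  ext z
  constructor
  · intro hz
    by_contra hz1
    exact hne z z.2 (fun h => hz1 (Subtype.ext h)) (hO' hz)
  · rintro rfl
    exact h1

theorem exists_symplectic_quotient_center {α : Form E G 1} (h : α.IsLeftInvariant)
    (hα : α.IsContact) (hZ : ¬DiscreteTopology (Subgroup.center G)) :
    ∃ (n : ℕ) (_ : ChartedSpace (EuclideanSpace ℝ (Fin n)) (G ⧸ Subgroup.center G)),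
      IsQuotientLieGroup E (EuclideanSpace ℝ (Fin n)) (Subgroup.center G) ∧
      ∃ Ω : Form (EuclideanSpace ℝ (Fin n)) (G ⧸ Subgroup.center G) 2,
        Ω.IsLeftInvariant ∧ Ω.IsSymplectic ∧
        Ω.pullback (QuotientGroup.mk : G → G ⧸ Subgroup.center G) = -α.d := by
  have : IsTopologicalGroup G := topologicalGroup_of_lieGroup 𝓘(ℝ, E) ∞
  obtain ⟨hαs, p, hp, hw⟩ := hα
  obtain ⟨hk0, hk1⟩ := ker_of_wedge_wedgePow_ne_zero (a := (α.val 1).toAlternatingMap)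
    (b := (α.d.val 1).toAlternatingMap) hp (hw 1)
  obtain ⟨n, f, hf, hfZ, hfs, hfker⟩ := h.exists_invariant_submersion hαs
  have hmem : ∀ u : E, u ∈ LinearMap.ker (toBilin (α.d.val 1).toAlternatingMap) ↔
      ∀ v, α.d.val 1 ![u, v] = 0 := fun u => by
    rw [LinearMap.mem_ker, LinearMap.ext_iff]; rfl
  -- The coordinate transverse to f is α at the identity, which the contact condition makes nonzero
  -- on the line ker dα.
  let l : E →L[ℝ] ℝ := LinearMap.toContinuousLinearMap
    { toFun := fun u => α.val 1 ![u]
      map_add' := fun x y => (α.val 1).toAlternatingMap.map_vecCons_add _ _ _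
      map_smul' := fun c x => (α.val 1).toAlternatingMap.map_vecCons_smul _ _ _ }
  have hker : ∀ u, tderiv E (EuclideanSpace ℝ (Fin n)) f 1 u = 0 → l u = 0 → u = 0 :=
    fun u hu hlu => hk0 u hlu ((hfker u).mp hu)
  obtain ⟨k', hk', hk'0⟩ : ∃ k ∈ LinearMap.ker (toBilin (α.d.val 1).toAlternatingMap), k ≠ 0 := by
    refine Submodule.exists_mem_ne_zero_of_ne_bot fun hbot => ?_
    rw [hbot, finrank_bot] at hk1
    exact zero_ne_one hk1
  have hk'f := (hfker k').mpr ((hmem k').mp hk')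
  have hlk' : l k' ≠ 0 := fun h0 => hk'0 (hker k' hk'f h0)
  obtain ⟨D, rfl⟩ := exists_quotientChart (isClosed_center_of_lieGroup E)
    (exists_ne_one_mem_of_not_discrete hZ) hf hfZ hfs (k := (l k')⁻¹ • k') (l := l)
    (by rw [map_smul, hk'f, smul_zero])
    (by rw [map_smul, smul_eq_mul, inv_mul_cancel₀ hlk']) hker
  let _ := D.chartedSpace
  have hQ := D.isQuotientLieGroup
  have := hQ.lieGroup
  refine ⟨n, D.chartedSpace, hQ, ?_⟩
  refine h.exists_symplectic hαs (π := QuotientGroup.mk' (Subgroup.center G)) D.contMDiff_mk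
    (QuotientGroup.mk'_surjective _) hQ.surjective_mfderiv_mk fun u => ?_
  rw [← hfker]
  -- Both derivatives map E onto the same space, so their kernels have equal dimension and the known
  -- inclusion is an equality.
  refine ⟨D.tderiv_f_eq_zero u, fun hu => ?_⟩
  have hle : LinearMap.ker (tderiv E (EuclideanSpace ℝ (Fin n))
      (QuotientGroup.mk' (Subgroup.center G)) 1).toLinearMap ≤
      LinearMap.ker (tderiv E (EuclideanSpace ℝ (Fin n)) D.f 1).toLinearMap :=
    fun u hu => D.tderiv_f_eq_zero u hu
  have hr1 := LinearMap.finrank_range_add_finrank_ker (tderiv E (EuclideanSpace ℝ (Fin n))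
      (QuotientGroup.mk' (Subgroup.center G)) 1).toLinearMap
  have hr2 := LinearMap.finrank_range_add_finrank_ker
    (tderiv E (EuclideanSpace ℝ (Fin n)) D.f 1).toLinearMap
  rw [LinearMap.range_eq_top.mpr hfs] at hr2
  have hs1 : LinearMap.range (tderiv E (EuclideanSpace ℝ (Fin n))
      (QuotientGroup.mk' (Subgroup.center G)) 1).toLinearMap = ⊤ :=
    LinearMap.range_eq_top.mpr (hQ.surjective_mfderiv_mk 1)
  rw [hs1] at hr1
  have heq := Submodule.eq_of_le_of_finrank_eq hle (by omega)
  have : u ∈ LinearMap.ker (tderiv E (EuclideanSpace ℝ (Fin n)) D.f 1).toLinearMap := hu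
  rw [← heq] at this
  exact this

end Quotient

/-! ### Part (b): the contact form of a central extension. -/

section CentralExtension

variable {E : Type*} [NormedAddCommGroup E] [NormedSpace ℝ E] [FiniteDimensional ℝ E]
  {K : Type*} [TopologicalSpace K] [ChartedSpace E K] [Group K] [LieGroup 𝓘(ℝ, E) ∞ K]
  {F : Type*} [NormedAddCommGroup F] [NormedSpace ℝ F] [FiniteDimensional ℝ F]
  {G : Type*} [TopologicalSpace G] [ChartedSpace F G] [Group G] [LieGroup 𝓘(ℝ, F) ∞ G]

/-- A linear functional as an alternating `1`-form. -/
def ofLinear (l : F →L[ℝ] ℝ) : F [⋀^Fin 1]→L[ℝ] ℝ :=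
  ContinuousAlternatingMap.ofSubsingleton ℝ F ℝ (0 : Fin 1) l

theorem ofLinear_apply (l : F →L[ℝ] ℝ) (v : Fin 1 → F) : ofLinear l v = l (v 0) := rfl

/-- Left translation carries ξ and the family to any point x without changing the values of α and
dα, so nonvanishing at the identity spreads to G. -/
theorem Form.IsLeftInvariant.isContact_of_one {α : Form F G 1} (h : α.IsLeftInvariant)
    (hα : α.IsSmooth) {p : ℕ} (hp : Module.finrank ℝ F = 2 * p + 1) {ξ : F}
    (hξ : α.val 1 ![ξ] = 1) {v : Fin p × Fin 2 → F} (hv : ∀ i, α.val 1 ![v i] = 0)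
    (hs : IsSymplecticFamily (-α.d.val 1).toAlternatingMap v) : α.IsContact := by
  refine ⟨hα, p, hp, fun x => ?_⟩
  -- Swapping the two members of each pair turns a symplectic family for -dα into one for dα.
  let v' : Fin p × Fin 2 → F := fun i => v (i.1, Equiv.swap 0 1 i.2)
  let L := tderiv F F (fun y => x * y) 1
  have h1 : ∀ u : F, α.val x ![L u] = α.val 1 ![u] := fun u => by
    have h2 := h.val_mul x 1
    rw [mul_one] at h2
    rw [← h2]
    change _ = α.val x fun i => L (![u] i)
    congr 1
    ext i; fin_cases i; rfl
  have h2 : ∀ u w : F, α.d.val x ![L u, L w] = α.d.val 1 ![u, w] := fun u w => by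
    have h2 := (h.d hα).val_mul x 1
    rw [mul_one] at h2
    rw [← h2]
    change _ = α.d.val x fun i => L (![u, w] i)
    congr 1
    ext i; fin_cases i <;> rfl
  refine wedge_wedgePow_ne_zero (a := (α.val x).toAlternatingMap)
    (b := (α.d.val x).toAlternatingMap) (v := fun i => L (v' i)) (ξ := L ξ) ⟨fun i => ?_,
      fun i j r s hij => ?_⟩ ((h1 ξ).trans hξ) fun i => (h1 _).trans (hv _)
  · refine (h2 _ _).trans ?_
    have h3 : -α.d.val 1 ![v (i, 0), v (i, 1)] = 1 := hs.1 i
    have h4 := map_pair_swap (α.d.val 1).toAlternatingMap (v (i, 0)) (v (i, 1))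
    exact h4.trans h3
  · refine (h2 _ _).trans ?_
    have h3 : -α.d.val 1 ![v' (i, r), v' (j, s)] = 0 := hs.2 i j _ _ hij
    exact neg_eq_zero.mp h3

theorem exists_contact_of_centralExtension {Ω : Form E K 2} (h : Ω.IsLeftInvariant)
    (hΩ : Ω.IsSymplectic)
    (e : GroupLieAlgebra 𝓘(ℝ, F) G ≃ₗ[ℝ] ℝ × GroupLieAlgebra 𝓘(ℝ, E) K)
    (he : ∀ u v : GroupLieAlgebra 𝓘(ℝ, F) G,
      e ⁅u, v⁆ = centralExtensionBracket (fun a b => Ω 1 ![a, b]) (e u) (e v)) :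
    ∃ α : Form F G 1, α.IsLeftInvariant ∧ α.IsContact ∧
      (∀ u v : GroupLieAlgebra 𝓘(ℝ, F) G, Ω 1 ![(e u).2, (e v).2] = -(α.d 1 ![u, v])) ∧
      (∀ π : G →* K, ContMDiff 𝓘(ℝ, F) 𝓘(ℝ, E) ∞ π →
        (∀ u : GroupLieAlgebra 𝓘(ℝ, F) G,
          (mfderiv 𝓘(ℝ, F) 𝓘(ℝ, E) π 1 u : E) = ((e u).2 : E)) →
        Ω.pullback π = -α.d) := by
  let e' : F ≃ₗ[ℝ] ℝ × E := e
  let l : F →L[ℝ] ℝ := LinearMap.toContinuousLinearMap ((LinearMap.fst ℝ ℝ E).comp e'.toLinearMap)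
  have hl : ∀ u, l u = (e' u).1 := fun u => rfl
  let α : Form F G 1 := Form.leftInvariant G (ofLinear l)
  have hα : α.IsLeftInvariant := Form.isLeftInvariant_leftInvariant _
  have hαs : α.IsSmooth := Form.isSmooth_leftInvariant _
  have hα1 : ∀ u : F, α.val 1 ![u] = (e' u).1 := fun u => by
    rw [Form.val_one_leftInvariant, ofLinear_apply]; rfl
  -- The first component of the bracket in the extension is ω, and dα is minus α of the bracket.
  have hd : ∀ u v : F, Ω.val 1 ![(e' u).2, (e' v).2] = -(α.d.val 1 ![u, v]) := fun u v => by
    rw [hα.val_d_one_apply hαs, neg_neg, hα1]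
    exact (congrArg Prod.fst (he u v)).symm
  refine ⟨α, hα, ?_, hd, fun π hπ hdπ => ?_⟩
  · obtain ⟨p, v, hp, hv⟩ := exists_symplecticFamily (Ω.val 1).toAlternatingMap (hΩ.2.2 1)
    -- (1, 0) spans the kernel of the projection to L(K) and α equals 1 on it. Lifting the family
    -- with first coordinate 0 puts it in ker α.
    refine hα.isContact_of_one hαs (p := p) (ξ := e'.symm (1, 0))
      (v := fun i => e'.symm (0, v i)) ?_ ?_ (fun i => ?_) ⟨fun i => ?_, fun i j r s hij => ?_⟩
    · rw [e'.finrank_eq, Module.finrank_prod, Module.finrank_self, hp, add_comm]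
    · rw [hα1, LinearEquiv.apply_symm_apply]
    · rw [hα1, LinearEquiv.apply_symm_apply]
    · have h1 := hd (e'.symm (0, v (i, 0))) (e'.symm (0, v (i, 1)))
      rw [LinearEquiv.apply_symm_apply, LinearEquiv.apply_symm_apply] at h1
      exact h1.symm.trans (hv.1 i)
    · have h1 := hd (e'.symm (0, v (i, r))) (e'.symm (0, v (j, s)))
      rw [LinearEquiv.apply_symm_apply, LinearEquiv.apply_symm_apply] at h1
      exact h1.symm.trans (hv.2 i j r s hij)
  · refine (h.pullback hπ).ext (hα.d hαs).neg ?_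
    have h0 : ∀ u : F, tderiv F E π 1 u = (e' u).2 := hdπ
    rw [Form.val_pullback, map_one]
    ext v
    have hv : v = ![v 0, v 1] := by ext i; fin_cases i <;> rfl
    have h1 : (fun i => tderiv F E π 1 (v i)) = ![(e' (v 0)).2, (e' (v 1)).2] := by
      ext i; fin_cases i <;> exact h0 _
    change Ω.val 1 (fun i => tderiv F E π 1 (v i)) = -(α.d.val 1 v)
    rw [h1, hd, ← hv]

end CentralExtension

end ContactLie
end

theorem mainTheorem6 :
    -- (a)
    (∀ (E : Type*) [NormedAddCommGroup E] [NormedSpace ℝ E] [FiniteDimensional ℝ E]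
      (G : Type*) [TopologicalSpace G] [ChartedSpace E G] [Group G] [LieGroup 𝓘(ℝ, E) ∞ G]
      (α : ContactLie.Form E G 1), α.IsLeftInvariant → α.IsContact →
      ¬ DiscreteTopology (Subgroup.center G) →
      ∃ (n : ℕ) (_ : ChartedSpace (EuclideanSpace ℝ (Fin n)) (G ⧸ Subgroup.center G)),
        ContactLie.IsQuotientLieGroup E (EuclideanSpace ℝ (Fin n)) (Subgroup.center G) ∧
        ∃ Ω : ContactLie.Form (EuclideanSpace ℝ (Fin n)) (G ⧸ Subgroup.center G) 2,
          Ω.IsLeftInvariant ∧ Ω.IsSymplectic ∧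
          Ω.pullback (QuotientGroup.mk : G → G ⧸ Subgroup.center G) = -α.d) ∧
    -- (b)
    (∀ (E : Type*) [NormedAddCommGroup E] [NormedSpace ℝ E] [FiniteDimensional ℝ E]
      (K : Type*) [TopologicalSpace K] [ChartedSpace E K] [Group K] [LieGroup 𝓘(ℝ, E) ∞ K]
      (Ω : ContactLie.Form E K 2), Ω.IsLeftInvariant → Ω.IsSymplectic →
      ∀ (F : Type*) [NormedAddCommGroup F] [NormedSpace ℝ F] [FiniteDimensional ℝ F]
        (G : Type*) [TopologicalSpace G] [ChartedSpace F G] [Group G] [LieGroup 𝓘(ℝ, F) ∞ G]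
        (e : GroupLieAlgebra 𝓘(ℝ, F) G ≃ₗ[ℝ] ℝ × GroupLieAlgebra 𝓘(ℝ, E) K),
        (∀ u v : GroupLieAlgebra 𝓘(ℝ, F) G,
          e ⁅u, v⁆ = ContactLie.centralExtensionBracket (fun a b => Ω 1 ![a, b]) (e u) (e v)) →
        ∃ α : ContactLie.Form F G 1, α.IsLeftInvariant ∧ α.IsContact ∧
          (∀ u v : GroupLieAlgebra 𝓘(ℝ, F) G,
            Ω 1 ![(e u).2, (e v).2] = -(α.d 1 ![u, v])) ∧
          (∀ π : G →* K, ContMDiff 𝓘(ℝ, F) 𝓘(ℝ, E) ∞ π →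
            (∀ u : GroupLieAlgebra 𝓘(ℝ, F) G,
              (mfderiv 𝓘(ℝ, F) 𝓘(ℝ, E) π 1 u : E) = ((e u).2 : E)) →
            Ω.pullback π = -α.d)) := by
  refine ⟨?_, ?_⟩
  · intro E _ _ _ G _ _ _ _ α h hα hZ
    exact ContactLie.exists_symplectic_quotient_center h hα hZ
  · intro E _ _ _ K _ _ _ _ Ω h hΩ F _ _ _ G _ _ _ _ e he
    exact ContactLie.exists_contact_of_centralExtension h hΩ e he
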